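/- Let $d \ge 2$ and let $\Omega \subset \mathbb{R}^d$ be a bounded, connected, open set (non-empty) with boundary $\Gamma$. Let $\sigma$ be the $(d-1)$-dimensional Hausdorff measure on $\Gamma$ and suppose that $\sigma(\Gamma) < \infty$. All functions are real-valued and $L_2(\Gamma) = L_2(\Gamma,\sigma)$. A function $\varphi \in L_2(\Gamma)$ is called a trace of $u \in H^1(\Omega)$ if there are $u_n \in H^1(\Omega) \cap C(\overline\Omega)$ with $u_n \to u$ in $H^1(\Omega)$ and $u_n|_\Gamma \to \varphi$ in $L_2(\Gamma)$. If $u \in H^1(\Omega)$ and the distributional Laplacian $\Delta u$ belongs to $L_2(\Omega)$, then $\psi \in L_2(\Gamma)$ is called the normal derivative of $u$ if $$\int_\Omega (\Delta u)\, v + \int_\Omega \nabla u \cdot \nabla v = \int_\Gamma \psi\, v \, d\sigma \qquad \text{for all } v \in H^1(\Omega) \cap C(\overline\Omega).$$ The Dirichlet-to-Neumann operator $D_0$ on $L_2(\Gamma)$ is given by: $\varphi \in D(D_0)$ and $D_0 \varphi = \psi$ if and only if there is a $u \in H^1(\Omega)$ such that $\Delta u = 0$ as a distribution, $\varphi$ is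 a trace of $u$, and $\psi$ is the normal derivative of $u$. Then $-D_0$ is the generator of a (unique) $C_0$-semigroup $S = (S_t)_{t \ge 0}$ on $L_2(\Gamma)$ (in particular $D_0$ is single-valued), and $S$ is Markovian: for all $t > 0$ one has $S_t \varphi \ge 0$ for every $\varphi \in L_2(\Gamma)$ with $\varphi \ge 0$, and $S_t \mathbb{1}_\Gamma = \mathbb{1}_\Gamma$. -/

import Mathlib

open MeasureTheory Filter Topology Set
open scoped ContDiff NNReal ENNReal

noncomputable section

namespace DirichletNeumann

/-! ### Strongly continuous semigroups and their generators -/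

/-- A strongly continuous one-parameter semigroup (C₀-semigroup) of bounded operators on `H`. -/
structure C0Semigroup (H : Type*) [NormedAddCommGroup H] [NormedSpace ℝ H] where
  /-- the operator at time `t` -/
  op : ℝ≥0 → H →L[ℝ] H
  op_zero : op 0 = ContinuousLinearMap.id ℝ H
  op_add : ∀ s t : ℝ≥0, op (s + t) = (op s).comp (op t)
  tendsto_zero : ∀ x : H, Tendsto (fun t : ℝ≥0 => op t x) (𝓝[>] 0) (𝓝 x)

/-- The graph of the (infinitesimal) generator `B` of a C₀-semigroup `S`: `x ∈ D(B)` and `B x = y`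
if and only if `(S_t x - x) / t → y` as `t ↓ 0`. -/
def C0Semigroup.generatorGraph {H : Type*} [NormedAddCommGroup H] [NormedSpace ℝ H]
    (S : C0Semigroup H) : Set (H × H) :=
  {p | Tendsto (fun t : ℝ≥0 => (t : ℝ)⁻¹ • (S.op t p.1 - p.1)) (𝓝[>] 0) (𝓝 p.2)}

/-- A C₀-semigroup on `L₂` of a finite measure space is Markovian if for all `t > 0` the operator
`S_t` is positive and maps the constant function `1` to itself. -/
def C0Semigroup.IsMarkovian {X : Type*} [MeasurableSpace X] {μ : Measure X} [IsFiniteMeasure μ]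
    (S : C0Semigroup (Lp ℝ 2 μ)) : Prop :=
  ∀ t : ℝ≥0, 0 < t →
    (∀ f : Lp ℝ 2 μ, 0 ≤ f → 0 ≤ S.op t f) ∧ S.op t (Lp.const 2 μ 1) = Lp.const 2 μ 1

/-! ### The Sobolev space `H¹(Ω)` -/

variable {d : ℕ}

/-- `φ ∈ C_c^∞(Ω)`. -/
structure IsTestFunction (Ω : Set (EuclideanSpace ℝ (Fin d)))
    (φ : EuclideanSpace ℝ (Fin d) → ℝ) : Prop where
  contDiff : ContDiff ℝ ∞ φ
  hasCompactSupport : HasCompactSupport φ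
  tsupport_subset : tsupport φ ⊆ Ω

/-- The vector field `G` is the weak (distributional) gradient of `u` on `Ω`:
`∫_Ω u ∂_v φ = - ∫_Ω φ (G · v)` for all test functions `φ` and all directions `v`. -/
def HasWeakGradient (Ω : Set (EuclideanSpace ℝ (Fin d))) (u : EuclideanSpace ℝ (Fin d) → ℝ)
    (G : EuclideanSpace ℝ (Fin d) → EuclideanSpace ℝ (Fin d)) : Prop :=
  ∀ φ : EuclideanSpace ℝ (Fin d) → ℝ, IsTestFunction Ω φ → ∀ v : EuclideanSpace ℝ (Fin d),
    ∫ x in Ω, u x * fderiv ℝ φ x v = - ∫ x in Ω, φ x * inner ℝ (G x) v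

/-- `h` is the distributional Laplacian of `u` on `Ω`. -/
def HasWeakLaplacian (Ω : Set (EuclideanSpace ℝ (Fin d)))
    (u h : EuclideanSpace ℝ (Fin d) → ℝ) : Prop :=
  ∀ φ : EuclideanSpace ℝ (Fin d) → ℝ, IsTestFunction Ω φ →
    ∫ x in Ω, u x * Laplacian.laplacian φ x = ∫ x in Ω, h x * φ x

lemma IsTestFunction.memLp {Ω : Set (EuclideanSpace ℝ (Fin d))}
    {φ : EuclideanSpace ℝ (Fin d) → ℝ} (h : IsTestFunction Ω φ) :
    MemLp φ 2 (volume.restrict Ω) :=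
  (h.contDiff.continuous.memLp_of_hasCompactSupport h.hasCompactSupport).restrict Ω

lemma IsTestFunction.memLp_fderiv {Ω : Set (EuclideanSpace ℝ (Fin d))}
    {φ : EuclideanSpace ℝ (Fin d) → ℝ} (h : IsTestFunction Ω φ)
    (v : EuclideanSpace ℝ (Fin d)) :
    MemLp (fun x => fderiv ℝ φ x v) 2 (volume.restrict Ω) := by
  refine (Continuous.memLp_of_hasCompactSupport ?_ ?_).restrict Ω
  · exact (h.contDiff.continuous_fderiv (by simp)).clm_apply continuous_const
  · exact h.hasCompactSupport.fderiv_apply ℝ v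

/-- `H¹(Ω)`, realised as the space of all pairs `(u, ∇u)` with `u ∈ L₂(Ω)` whose weak gradient `∇u`
is in `L₂(Ω)^d`. The topology is that of the norm `‖u‖² = ∫_Ω |u|² + ∫_Ω |∇u|²`. -/
def H1 (Ω : Set (EuclideanSpace ℝ (Fin d))) :
    Submodule ℝ (WithLp 2 (Lp ℝ 2 (volume.restrict Ω) ×
      Lp (EuclideanSpace ℝ (Fin d)) 2 (volume.restrict Ω))) where
  carrier := {p | HasWeakGradient Ω p.fst p.snd}
  zero_mem' := by
    intro φ _ v
    have h1 : ∫ x in Ω, (0 : Lp ℝ 2 (volume.restrict Ω)) x * fderiv ℝ φ x v = 0 :=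
      integral_eq_zero_of_ae (by
        filter_upwards [Lp.coeFn_zero ℝ 2 (volume.restrict Ω)] with x hx
        rw [hx]; simp)
    have h2 : ∫ x in Ω, φ x * inner ℝ
        ((0 : Lp (EuclideanSpace ℝ (Fin d)) 2 (volume.restrict Ω)) x) v = 0 :=
      integral_eq_zero_of_ae (by
        filter_upwards [Lp.coeFn_zero (EuclideanSpace ℝ (Fin d)) 2 (volume.restrict Ω)] with x hx
        rw [hx]; simp)
    rw [WithLp.zero_fst, WithLp.zero_snd, h1, h2, neg_zero]
  add_mem' := by
    intro p q hp hq φ hφ v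
    have i1 (f : Lp ℝ 2 (volume.restrict Ω)) :
        Integrable (fun x => f x * fderiv ℝ φ x v) (volume.restrict Ω) :=
      (Lp.memLp f).integrable_mul (hφ.memLp_fderiv v)
    have i2 (G : Lp (EuclideanSpace ℝ (Fin d)) 2 (volume.restrict Ω)) :
        Integrable (fun x => φ x * inner ℝ (G x) v) (volume.restrict Ω) :=
      hφ.memLp.integrable_mul ((Lp.memLp G).inner_const v)
    have h1 : ∫ x in Ω, (p.fst + q.fst) x * fderiv ℝ φ x v
        = (∫ x in Ω, p.fst x * fderiv ℝ φ x v) + ∫ x in Ω, q.fst x * fderiv ℝ φ x v := by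
      rw [← integral_add (i1 _) (i1 _)]
      refine integral_congr_ae ?_
      filter_upwards [Lp.coeFn_add p.fst q.fst] with x hx
      rw [hx, Pi.add_apply, add_mul]
    have h2 : ∫ x in Ω, φ x * inner ℝ ((p.snd + q.snd) x) v
        = (∫ x in Ω, φ x * inner ℝ (p.snd x) v) + ∫ x in Ω, φ x * inner ℝ (q.snd x) v := by
      rw [← integral_add (i2 _) (i2 _)]
      refine integral_congr_ae ?_
      filter_upwards [Lp.coeFn_add p.snd q.snd] with x hx
      rw [hx, Pi.add_apply, inner_add_left, mul_add]
    rw [WithLp.add_fst, WithLp.add_snd, h1, h2, hp φ hφ v, hq φ hφ v]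
    ring
  smul_mem' := by
    intro c p hp φ hφ v
    have h1 : ∫ x in Ω, (c • p.fst) x * fderiv ℝ φ x v
        = c * ∫ x in Ω, p.fst x * fderiv ℝ φ x v := by
      rw [← integral_const_mul]
      refine integral_congr_ae ?_
      filter_upwards [Lp.coeFn_smul c p.fst] with x hx
      rw [hx, Pi.smul_apply, smul_eq_mul, mul_assoc]
    have h2 : ∫ x in Ω, φ x * inner ℝ ((c • p.snd) x) v
        = c * ∫ x in Ω, φ x * inner ℝ (p.snd x) v := by
      rw [← integral_const_mul]
      refine integral_congr_ae ?_
      filter_upwards [Lp.coeFn_smul c p.snd] with x hx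
      rw [hx, Pi.smul_apply, real_inner_smul_left]
      ring
    rw [WithLp.smul_fst, WithLp.smul_snd, h1, h2, hp φ hφ v]
    ring

/-- The element of `L₂(Ω)` underlying `u ∈ H¹(Ω)`. -/
def toL2 {Ω : Set (EuclideanSpace ℝ (Fin d))} (u : H1 Ω) : Lp ℝ 2 (volume.restrict Ω) :=
  (u : WithLp 2 (Lp ℝ 2 (volume.restrict Ω) ×
    Lp (EuclideanSpace ℝ (Fin d)) 2 (volume.restrict Ω))).fst

/-- The weak gradient `∇u` of `u ∈ H¹(Ω)`. -/
def grad {Ω : Set (EuclideanSpace ℝ (Fin d))} (u : H1 Ω) :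
    Lp (EuclideanSpace ℝ (Fin d)) 2 (volume.restrict Ω) :=
  (u : WithLp 2 (Lp ℝ 2 (volume.restrict Ω) ×
    Lp (EuclideanSpace ℝ (Fin d)) 2 (volume.restrict Ω))).snd

/-! ### Traces, normal derivatives and the Dirichlet-to-Neumann operator -/

/-- The `(d-1)`-dimensional Hausdorff measure `σ` on the boundary `Γ = ∂Ω` (as a measure on `ℝ^d`
concentrated on `Γ`), so that `L₂(Γ)` is `Lp ℝ 2 (boundaryMeasure Ω)`. -/
def boundaryMeasure (Ω : Set (EuclideanSpace ℝ (Fin d))) :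
    Measure (EuclideanSpace ℝ (Fin d)) :=
  (Measure.hausdorffMeasure ((d : ℝ) - 1)).restrict (frontier Ω)

/-- `u ∈ H¹(Ω) ∩ C(closure Ω)` and `g = u|_Γ` in `L₂(Γ)`: the class `u` has a representative `w`
that is continuous on the closure of `Ω`, and `g` is the class of the restriction of `w` to `Γ`. -/
def IsContinuousWithRestriction (Ω : Set (EuclideanSpace ℝ (Fin d))) (u : H1 Ω)
    (g : Lp ℝ 2 (boundaryMeasure Ω)) : Prop :=
  ∃ w : EuclideanSpace ℝ (Fin d) → ℝ, ContinuousOn w (closure Ω) ∧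
    toL2 u =ᵐ[volume.restrict Ω] w ∧ g =ᵐ[boundaryMeasure Ω] w

/-- `φ ∈ L₂(Γ)` is a trace of `u ∈ H¹(Ω)`: there are `uₙ ∈ H¹(Ω) ∩ C(closure Ω)` such that
`uₙ → u` in `H¹(Ω)` and `uₙ|_Γ → φ` in `L₂(Γ)`. -/
def IsTrace (Ω : Set (EuclideanSpace ℝ (Fin d))) (u : H1 Ω)
    (φ : Lp ℝ 2 (boundaryMeasure Ω)) : Prop :=
  ∃ (us : ℕ → H1 Ω) (gs : ℕ → Lp ℝ 2 (boundaryMeasure Ω)),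
    (∀ n, IsContinuousWithRestriction Ω (us n) (gs n)) ∧
    Tendsto us atTop (𝓝 u) ∧ Tendsto gs atTop (𝓝 φ)

/-- `Δu ∈ L₂(Ω)`, and `ψ ∈ L₂(Γ)` is the normal derivative of `u ∈ H¹(Ω)`, in the sense of Green's
formula `∫_Ω (Δu) v + ∫_Ω ∇u · ∇v = ∫_Γ ψ v dσ` for all `v ∈ H¹(Ω) ∩ C(closure Ω)`. -/
def HasNormalDerivative (Ω : Set (EuclideanSpace ℝ (Fin d))) (u : H1 Ω)
    (ψ : Lp ℝ 2 (boundaryMeasure Ω)) : Prop :=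
  ∃ h : Lp ℝ 2 (volume.restrict Ω), HasWeakLaplacian Ω (toL2 u) h ∧
    ∀ (v : H1 Ω) (g : Lp ℝ 2 (boundaryMeasure Ω)), IsContinuousWithRestriction Ω v g →
      (∫ x in Ω, h x * toL2 v x) + ∫ x in Ω, inner ℝ (grad u x) (grad v x)
        = ∫ x, ψ x * g x ∂(boundaryMeasure Ω)

/-- The graph of the Dirichlet-to-Neumann operator `D₀` on `L₂(Γ)`: `φ ∈ D(D₀)` and `D₀ φ = ψ` if
and only if there is a harmonic `u ∈ H¹(Ω)` which has `φ` as a trace and `ψ` as normal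
derivative. -/
def dtnGraph (Ω : Set (EuclideanSpace ℝ (Fin d))) :
    Set (Lp ℝ 2 (boundaryMeasure Ω) × Lp ℝ 2 (boundaryMeasure Ω)) :=
  {p | ∃ u : H1 Ω, HasWeakLaplacian Ω (toL2 u) 0 ∧ IsTrace Ω u p.1 ∧ HasNormalDerivative Ω u p.2}

/-- `-D₀` is the generator of the C₀-semigroup `S` on `L₂(Γ)`, as an equality of graphs. A generator
is single-valued, so this includes that `D₀` is single-valued. -/
def IsGeneratedByNegDtN (Ω : Set (EuclideanSpace ℝ (Fin d)))
    (S : C0Semigroup (Lp ℝ 2 (boundaryMeasure Ω))) : Prop :=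
  S.generatorGraph = {p | (p.1, -p.2) ∈ dtnGraph Ω}

end DirichletNeumann

end

/-! The Dirichlet form on traces generates the semigroup. Let V be the closure in H¹(Ω) × L₂(Γ) of
the pairs (u, u|_Γ) with u continuous up to the boundary (`tracePairs`); its elements are the pairs
(u, φ) with φ a trace of u. Green's formula together with harmonicity of u says exactly that ⟨∇u,
∇v⟩ = ⟨ψ, g⟩ for all (v, g) in V (`harmonic_normalDerivative_iff`). Working with pairs avoids any
question whether u determines its trace.

D₀ is then a maximal monotone relation. Monotonicity is ⟨φ, ψ⟩ = ‖∇u‖². Surjectivity of l + D₀ is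
Lax–Milgram on V, where coercivity is Maz'ya's inequality ‖u‖² ≤ C(‖∇u‖² + ‖φ‖²)
(`exists_norm_toL2_sq_le`). That inequality needs no regularity of Γ: u(x) is compared with the
value of u where the ray from x in the first coordinate direction leaves Ω, and the map to this exit
point pushes Lebesgue measure forward to at most 2R times σ, because coordinate projections are
1-Lipschitz. If φ = 0, then ∇u = 0, so ψ is orthogonal to all smooth functions and vanishes;
single-valuedness in turn gives a dense domain.

The Hille–Yosida theorem (`IsMaximalMonotone.exists_semigroup`) constructs the semigroup by Yosida
approximation and shows that closed convex cones invariant under the resolvents stay invariant.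
Uniqueness follows because monotonicity makes the distance between two orbits with the same initial
value nonincreasing (`eq_of_generatorGraph`).

For positivity, the resolvent l(l + D₀)⁻¹f comes from minimising ‖∇u‖² + l‖φ‖² - 2l⟨f, φ⟩ on V. If f
≥ 0, passing to absolute values does not increase this functional, so φ = |φ|
(`nonneg_of_mem_dtnGraph`). Smooth approximations of |·| and a chain rule for weak gradients, proved
with difference quotients along segments, make this rigorous. Finally D₀𝟙 = 0, so 𝟙 is fixed. -/

noncomputable section
namespace DirichletNeumann

/-! ### Maximal monotone relations, resolvents and operator exponentials. -/

section Semigroup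

variable {H : Type*} [NormedAddCommGroup H] [InnerProductSpace ℝ H]

open scoped InnerProductSpace

/-- A linear relation on a Hilbert space that is monotone, has full range after adding any positive
multiple of the identity, and is densely defined. -/
structure IsMaximalMonotone (D : Submodule ℝ (H × H)) : Prop where
  inner_nonneg : ∀ p ∈ D, 0 ≤ ⟪p.1, p.2⟫_ℝ
  exists_mem : ∀ l : ℝ, 0 < l → ∀ f : H, ∃ x : H, (x, f - l • x) ∈ D
  dense_domain : Dense {x : H | ∃ y, (x, y) ∈ D}

/-- The normalised resolvent `l (l + D)⁻¹` as a contraction. -/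
lemma IsMaximalMonotone.exists_resolvent {D : Submodule ℝ (H × H)} (hD : IsMaximalMonotone D)
    {l : ℝ} (hl : 0 < l) :
    ∃ J : H →L[ℝ] H, ‖J‖ ≤ 1 ∧ (∀ f, (J f, l • (f - J f)) ∈ D) ∧
      ∀ x y, (x, y) ∈ D → J (x + l⁻¹ • y) = x := by
  -- The difference of the two pairs is (z, -l z) with z = x - x', so monotonicity gives -l‖z‖² ≥ 0.
  have uniq : ∀ f x x' : H, (x, l • (f - x)) ∈ D → (x', l • (f - x')) ∈ D → x = x' := by
    intro f x x' h h'
    have h1 := hD.inner_nonneg _ (D.sub_mem h h')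
    have h2 : l • (f - x) - l • (f - x') = -(l • (x - x')) := by module
    simp only [Prod.mk_sub_mk, h2, inner_neg_right, real_inner_smul_right,
      real_inner_self_eq_norm_sq] at h1
    have h3 : ‖x - x'‖ ^ 2 ≤ 0 := by
      by_contra hc
      push Not at hc
      nlinarith [mul_pos hl hc]
    have h4 : ‖x - x'‖ = 0 := by
      have := le_antisymm h3 (sq_nonneg _)
      exact pow_eq_zero_iff (two_ne_zero) |>.1 this
    exact sub_eq_zero.1 (norm_eq_zero.1 h4)
  have ex : ∀ f, ∃ x, (x, l • (f - x)) ∈ D := by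
    intro f
    obtain ⟨x, hx⟩ := hD.exists_mem l hl (l • f)
    exact ⟨x, by rwa [smul_sub]⟩
  choose J hJ using ex
  have bound : ∀ f, ‖J f‖ ≤ 1 * ‖f‖ := by
    intro f
    have h1 := hD.inner_nonneg _ (hJ f)
    simp only [real_inner_smul_right, inner_sub_right, real_inner_self_eq_norm_sq] at h1
    have h2 := real_inner_le_norm (J f) f
    have h3 : 0 ≤ ⟪J f, f⟫_ℝ - ‖J f‖ ^ 2 := nonneg_of_mul_nonneg_right h1 hl
    rw [one_mul]
    by_contra hc
    push Not at hc
    nlinarith [norm_nonneg (J f), norm_nonneg f]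
  let JL : H →ₗ[ℝ] H :=
    { toFun := J
      map_add' := fun f g => by
        refine uniq (f + g) _ _ (hJ _) ?_
        have := D.add_mem (hJ f) (hJ g)
        convert this using 1
        simp only [Prod.mk_add_mk, Prod.mk.injEq, true_and]
        module
      map_smul' := fun c f => by
        refine uniq (c • f) _ _ (hJ _) ?_
        have := D.smul_mem c (hJ f)
        convert this using 1
        simp only [Prod.smul_mk, Prod.mk.injEq, true_and, RingHom.id_apply]
        module }
  refine ⟨JL.mkContinuous 1 bound, JL.mkContinuous_norm_le zero_le_one bound, hJ, ?_⟩
  intro x y hxy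
  refine uniq _ _ _ (hJ _) ?_
  convert hxy using 2
  rw [add_sub_cancel_left, smul_smul, mul_inv_cancel₀ hl.ne', one_smul]

lemma norm_exp_le [CompleteSpace H] (A : H →L[ℝ] H) :
    ‖NormedSpace.exp A‖ ≤ Real.exp ‖A‖ := by
  have h := NormedSpace.exp_series_hasSum_exp' (𝕂 := ℝ) A
  have h2 := NormedSpace.exp_series_hasSum_exp' (𝕂 := ℝ) ‖A‖
  rw [← Real.exp_eq_exp_ℝ] at h2
  rw [← h.tsum_eq, ← h2.tsum_eq]
  refine tsum_of_norm_bounded h2.summable.hasSum fun n => ?_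
  rw [norm_smul, norm_inv, RCLike.norm_natCast, smul_eq_mul]
  have : ‖A ^ n‖ ≤ ‖A‖ ^ n := by
    -- On the trivial space the identity has norm 0, so the power 0 needs its own bound.
    rcases n.eq_zero_or_pos with rfl | hn
    · rw [pow_zero, pow_zero]
      exact ContinuousLinearMap.norm_id_le
    · exact norm_pow_le' A hn
  gcongr

/-- Splitting off e^(-c) leaves, for c ≥ 0, a power series in J with nonnegative coefficients. Both
contractivity and the invariance of cones are read off from this form. -/
lemma exp_smul_sub_one [CompleteSpace H] (J : H →L[ℝ] H) (c : ℝ) :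
    NormedSpace.exp (c • (J - 1)) = Real.exp (-c) • NormedSpace.exp (c • J) := by
  let _ : NormedAlgebra ℚ (H →L[ℝ] H) := NormedAlgebra.restrictScalars ℚ ℝ _
  have h1 : c • (J - 1) = (-c) • (1 : H →L[ℝ] H) + c • J := by module
  rw [h1, NormedSpace.exp_add_of_commute (Commute.smul_left (Commute.one_left _) _)]
  have : NormedSpace.exp ((-c) • (1 : H →L[ℝ] H)) = Real.exp (-c) • (1 : H →L[ℝ] H) := by
    rw [← Algebra.algebraMap_eq_smul_one, ← Algebra.algebraMap_eq_smul_one, Real.exp_eq_exp_ℝ,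
      NormedSpace.algebraMap_exp_comm]
  rw [this, smul_mul_assoc, one_mul]

lemma norm_exp_smul_sub_one_le [CompleteSpace H] {J : H →L[ℝ] H} (hJ : ‖J‖ ≤ 1) {c : ℝ}
    (hc : 0 ≤ c) : ‖NormedSpace.exp (c • (J - 1))‖ ≤ 1 := by
  rw [exp_smul_sub_one, norm_smul, Real.norm_eq_abs, abs_of_pos (Real.exp_pos _)]
  have h1 : ‖c • J‖ ≤ c := by
    rw [norm_smul, Real.norm_eq_abs, abs_of_nonneg hc]
    exact mul_le_of_le_one_right hc hJ
  calc Real.exp (-c) * ‖NormedSpace.exp (c • J)‖ ≤ Real.exp (-c) * Real.exp c := by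
        gcongr
        exact (norm_exp_le _).trans (Real.exp_le_exp.2 h1)
    _ = 1 := by rw [← Real.exp_add]; simp

/-- A closed convex cone that is invariant under `J` is invariant under `exp (c (J - 1))`. -/
lemma exp_smul_sub_one_mem [CompleteSpace H] {J : H →L[ℝ] H} {K : Set H} (hK : IsClosed K)
    (h0 : (0 : H) ∈ K) (hadd : ∀ x ∈ K, ∀ y ∈ K, x + y ∈ K)
    (hsmul : ∀ a : ℝ, 0 ≤ a → ∀ x ∈ K, a • x ∈ K) (hJ : ∀ x ∈ K, J x ∈ K) {c : ℝ} (hc : 0 ≤ c)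
    {x : H} (hx : x ∈ K) : NormedSpace.exp (c • (J - 1)) x ∈ K := by
  rw [exp_smul_sub_one]
  refine hsmul _ (Real.exp_pos _).le _ ?_
  have h := NormedSpace.exp_series_hasSum_exp' (𝕂 := ℝ) (c • J)
  have h2 := (ContinuousLinearMap.apply ℝ H x).hasSum h
  have hpow : ∀ n : ℕ, (J ^ n) x ∈ K := by
    intro n
    induction n with
    | zero => simpa using hx
    | succ n ih => rw [pow_succ']; exact hJ _ ih
  refine hK.mem_of_tendsto h2 (Eventually.of_forall fun s => ?_)
  refine Finset.sum_induction _ (· ∈ K) (fun a b ha hb => hadd a ha b hb) h0 fun n _ => ?_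
  have : (ContinuousLinearMap.apply ℝ H x) (((n.factorial : ℝ))⁻¹ • (c • J) ^ n)
      = (((n.factorial : ℝ))⁻¹ * c ^ n) • (J ^ n) x := by
    simp [smul_pow, smul_smul]
  refine Set.mem_of_eq_of_mem this ?_
  exact hsmul _ (by positivity) _ (hpow n)

lemma hasDerivAt_exp_smul_apply [CompleteSpace H] (A : H →L[ℝ] H) (x : H) (t : ℝ) :
    HasDerivAt (fun s : ℝ => NormedSpace.exp (s • A) x) (NormedSpace.exp (t • A) (A x)) t := by
  have := (hasDerivAt_exp_smul_const (𝕂 := ℝ) A t).clm_apply (hasDerivAt_const t x)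
  simpa using this

/-- The mean value inequality for s ↦ exp(sA)x - s y. It serves to identify the generator of the
limit semigroup by an estimate uniform in the approximants. -/
lemma norm_exp_smul_sub_sub_le [CompleteSpace H] (A : H →L[ℝ] H) (x y : H) {t C : ℝ} (ht : 0 ≤ t)
    (h : ∀ s, 0 ≤ s → s ≤ t → ‖NormedSpace.exp (s • A) (A x) - y‖ ≤ C) :
    ‖NormedSpace.exp (t • A) x - x - t • y‖ ≤ C * t := by
  have hd : ∀ s ∈ Icc (0 : ℝ) t, HasDerivWithinAt
      (fun s : ℝ => NormedSpace.exp (s • A) x - s • y) (NormedSpace.exp (s • A) (A x) - y)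
      (Icc 0 t) s := by
    intro s _
    refine (HasDerivAt.sub (hasDerivAt_exp_smul_apply A x s) ?_).hasDerivWithinAt
    simpa using (hasDerivAt_id s).smul_const y
  have := norm_image_sub_le_of_norm_deriv_le_segment' hd
    (fun s hs => h s hs.1 hs.2.le) t ⟨ht, le_rfl⟩
  convert this using 1
  · congr 1
    simp
    abel
  · ring

/-- The path s ↦ exp(sA) exp((t - s)B) x joins the two vectors, and by commutation its derivative is
exp(sA) exp((t - s)B)(Ax - Bx), of norm at most ‖Ax - Bx‖. -/
lemma norm_exp_smul_sub_exp_smul_le [CompleteSpace H] {A B : H →L[ℝ] H} (hAB : Commute A B)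
    (hA : ∀ s : ℝ, 0 ≤ s → ‖NormedSpace.exp (s • A)‖ ≤ 1)
    (hB : ∀ s : ℝ, 0 ≤ s → ‖NormedSpace.exp (s • B)‖ ≤ 1) (x : H) {t : ℝ} (ht : 0 ≤ t) :
    ‖NormedSpace.exp (t • A) x - NormedSpace.exp (t • B) x‖ ≤ ‖A x - B x‖ * t := by
  let _ : NormedAlgebra ℚ (H →L[ℝ] H) := NormedAlgebra.restrictScalars ℚ ℝ _
  have hd : ∀ s ∈ Icc (0 : ℝ) t, HasDerivWithinAt
      (fun s : ℝ => NormedSpace.exp (s • A) (NormedSpace.exp ((t - s) • B) x))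
      (NormedSpace.exp (s • A) (NormedSpace.exp ((t - s) • B) (A x - B x))) (Icc 0 t) s := by
    intro s _
    have h1 := hasDerivAt_exp_smul_const (𝕂 := ℝ) A s
    have h2 : HasDerivAt (fun s : ℝ => NormedSpace.exp ((t - s) • B) x)
        (-(NormedSpace.exp ((t - s) • B) (B x))) s := by
      have := (hasDerivAt_exp_smul_apply B x (t - s)).scomp s ((hasDerivAt_id s).const_sub t)
      simpa [Function.comp_def] using this
    have h3 := (h1.clm_apply h2).hasDerivWithinAt (s := Icc 0 t)
    convert h3 using 1
    have hc : Commute A (NormedSpace.exp ((t - s) • B)) := (hAB.smul_right _).exp_right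
    have hc' : A (NormedSpace.exp ((t - s) • B) x) = NormedSpace.exp ((t - s) • B) (A x) :=
      congrArg (fun T : H →L[ℝ] H => T x) hc.eq
    change _ = (NormedSpace.exp (s • A)) (A _) + _
    rw [hc', map_sub, map_sub, map_neg, sub_eq_add_neg]
  have := norm_image_sub_le_of_norm_deriv_le_segment' (C := ‖A x - B x‖) hd (fun s hs => by
    refine ((NormedSpace.exp (s • A)).le_of_opNorm_le (hA s hs.1) _).trans ?_
    rw [one_mul]
    refine ((NormedSpace.exp ((t - s) • B)).le_of_opNorm_le (hB _ (sub_nonneg.2 hs.2.le)) _).trans ?_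
    rw [one_mul]) t ⟨ht, le_rfl⟩
  simpa using this

lemma norm_exp_smul_sub_le [CompleteSpace H] {A : H →L[ℝ] H}
    (hA : ∀ s : ℝ, 0 ≤ s → ‖NormedSpace.exp (s • A)‖ ≤ 1) (x : H) {t : ℝ} (ht : 0 ≤ t) :
    ‖NormedSpace.exp (t • A) x - x‖ ≤ ‖A x‖ * t := by
  have := norm_exp_smul_sub_exp_smul_le (B := 0) (Commute.zero_right A) hA (fun s _ => by
    rw [smul_zero, NormedSpace.exp_zero]
    exact ContinuousLinearMap.norm_id_le) x ht
  simpa using this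

end Semigroup
-- The Hille–Yosida theorem by Yosida approximation.
section Generation

variable {H : Type*} [NormedAddCommGroup H] [InnerProductSpace ℝ H]

open scoped InnerProductSpace

/-- For (x, y) in D one has K y = m(x - K x), so K maps D entrywise into itself. Applied to the pair
that defines J f, this shows that K J f solves the equation characterising J K f. -/
lemma resolvent_commute {D : Submodule ℝ (H × H)} {J K : H →L[ℝ] H} {l m : ℝ} (hm : m ≠ 0)
    (hJ : ∀ f, (J f, l • (f - J f)) ∈ D) (hK : ∀ f, (K f, m • (f - K f)) ∈ D)
    (hJ' : ∀ x y, (x, y) ∈ D → J (x + l⁻¹ • y) = x)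
    (hK' : ∀ x y, (x, y) ∈ D → K (x + m⁻¹ • y) = x) (hl : l ≠ 0) : Commute J K := by
  have key : ∀ x y, (x, y) ∈ D → (K x, K y) ∈ D := by
    intro x y hxy
    have h1 := hK' x y hxy
    rw [map_add, map_smul] at h1
    have h2 : K y = m • (x - K x) := by
      nth_rewrite 1 [← h1]
      rw [add_sub_cancel_left, smul_smul, mul_inv_cancel₀ hm, one_smul]
    rw [h2]
    exact hK x
  refine ContinuousLinearMap.ext fun f => ?_
  have h1 := hJ' _ _ (key _ _ (hJ f))
  rw [map_smul, smul_smul, inv_mul_cancel₀ hl, one_smul, map_sub, add_sub_cancel] at h1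
  exact h1

/-- A pointwise limit property of operators of norm at most one that holds on a dense set holds
everywhere. -/
lemma cauchySeq_of_dense {T : ℕ → H →L[ℝ] H} (hT : ∀ n, ‖T n‖ ≤ 1) {s : Set H} (hs : Dense s)
    (h : ∀ x ∈ s, CauchySeq fun n => T n x) (x : H) : CauchySeq fun n => T n x := by
  rw [Metric.cauchySeq_iff]
  intro ε hε
  obtain ⟨z, hz, hzx⟩ := Metric.dense_iff.1 hs x (ε / 3) (by positivity)
  obtain ⟨N, hN⟩ := Metric.cauchySeq_iff.1 (h _ hzx) (ε / 3) (by positivity)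
  refine ⟨N, fun m hm n hn => ?_⟩
  have hb (k : ℕ) : dist (T k x) (T k z) < ε / 3 := by
    rw [dist_eq_norm, ← map_sub]
    refine ((T k).le_of_opNorm_le (hT k) _).trans_lt ?_
    rw [one_mul, ← dist_eq_norm, dist_comm]
    exact Metric.mem_ball.1 hz
  have h1 := hb m
  have h2 := hb n
  have h3 := hN m hm n hn
  rw [dist_comm] at h2
  linarith [dist_triangle4 (T m x) (T m z) (T n z) (T n x)]

/-- The Hille–Yosida theorem for maximal monotone linear relations on a Hilbert space. A closed
convex cone that is invariant under the resolvent is invariant under the semigroup. -/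
theorem IsMaximalMonotone.exists_semigroup [CompleteSpace H] {D : Submodule ℝ (H × H)} (hD : IsMaximalMonotone D)
    {K : Set H} (hK : IsClosed K)
    (h0 : (0 : H) ∈ K) (hadd : ∀ x ∈ K, ∀ y ∈ K, x + y ∈ K)
    (hsmul : ∀ a : ℝ, 0 ≤ a → ∀ x ∈ K, a • x ∈ K)
    (hres : ∀ l : ℝ, 0 < l → ∀ f ∈ K, ∀ x, (x, l • (f - x)) ∈ D → x ∈ K) :
    ∃ S : C0Semigroup H, S.generatorGraph = {p | (p.1, -p.2) ∈ D} ∧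
      (∀ t, ‖S.op t‖ ≤ 1) ∧ (∀ t, ∀ x ∈ K, S.op t x ∈ K) ∧
      ∀ x, (x, 0) ∈ D → ∀ t, S.op t x = x := by
  let lam : ℕ → ℝ := fun n => n + 1
  have hlam : ∀ n, 0 < lam n := fun n => by positivity
  choose J hJ1 hJ2 hJ3 using fun n => hD.exists_resolvent (hlam n)
  -- The Yosida approximants of -D: bounded, commuting, generating contractions, and equal to -J n y
  -- on a pair (x, y) of D.
  let A : ℕ → H →L[ℝ] H := fun n => lam n • (J n - 1)
  let T : ℕ → ℝ → H →L[ℝ] H := fun n t => NormedSpace.exp (t • A n)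
  have hTsmul : ∀ n t, t • A n = (t * lam n) • (J n - 1) := fun n t => smul_smul _ _ _
  have hT1 : ∀ n t, 0 ≤ t → ‖T n t‖ ≤ 1 := by
    intro n t ht
    simp only [T, hTsmul]
    exact norm_exp_smul_sub_one_le (hJ1 n) (mul_nonneg ht (hlam n).le)
  have hcomm : ∀ m n, Commute (A m) (A n) := by
    intro m n
    have := resolvent_commute (hlam n).ne' (hJ2 m) (hJ2 n) (hJ3 m) (hJ3 n) (hlam m).ne'
    exact ((this.sub_left (Commute.one_left _)).sub_right (Commute.one_right _)).smul_left _
      |>.smul_right _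
  have hAJ : ∀ x y, (x, y) ∈ D → ∀ n, A n x = - J n y := by
    intro x y hxy n
    have h1 := hJ3 n x y hxy
    rw [map_add, map_smul] at h1
    change lam n • (J n x - x) = _
    have h2 : J n x - x = - ((lam n)⁻¹ • J n y) := by
      nth_rewrite 2 [← h1]; abel
    rw [h2, smul_neg, smul_smul, mul_inv_cancel₀ (hlam n).ne', one_smul]
  have hlim : Tendsto (fun n => (lam n)⁻¹) atTop (𝓝 0) := by
    simpa [lam] using tendsto_one_div_add_atTop_nhds_zero_nat (𝕜 := ℝ)
  -- On the dense domain ‖J n z - z‖ ≤ ‖w‖ / lam n for (z, w) in D; contractivity extends the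
  -- convergence to all vectors.
  have hJlim : ∀ y, Tendsto (fun n => J n y) atTop (𝓝 y) := by
    intro y
    rw [Metric.tendsto_atTop]
    intro ε hε
    obtain ⟨z, hz, w, hzw⟩ := Metric.dense_iff.1 hD.dense_domain y (ε / 3) (by positivity)
    have hzy : ‖y - z‖ < ε / 3 := by
      rw [← dist_eq_norm, dist_comm]; exact Metric.mem_ball.1 hz
    have h1 : ∀ n, ‖J n z - z‖ ≤ (lam n)⁻¹ * ‖w‖ := by
      intro n
      have h1 := hJ3 n z w hzw
      rw [map_add, map_smul] at h1
      have h2 : J n z - z = - ((lam n)⁻¹ • J n w) := by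
        nth_rewrite 2 [← h1]; abel
      rw [h2, norm_neg, norm_smul, norm_inv, Real.norm_eq_abs, abs_of_pos (hlam n)]
      have := (J n).le_of_opNorm_le (hJ1 n) w
      rw [one_mul] at this
      have := hlam n
      gcongr
    have h2 : Tendsto (fun n => (lam n)⁻¹ * ‖w‖) atTop (𝓝 0) := by
      simpa using hlim.mul_const ‖w‖
    obtain ⟨N, hN⟩ := eventually_atTop.1 (h2.eventually (gt_mem_nhds (show (0 : ℝ) < ε / 3 by
      positivity)))
    refine ⟨N, fun n hn => ?_⟩
    rw [dist_eq_norm]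
    have h3 : J n y - y = J n (y - z) + (J n z - z) - (y - z) := by
      rw [map_sub]; abel
    have h4 := (J n).le_of_opNorm_le (hJ1 n) (y - z)
    rw [h3]
    calc _ ≤ ‖J n (y - z)‖ + ‖J n z - z‖ + ‖y - z‖ :=
          (norm_sub_le _ _).trans (by gcongr; exact norm_add_le _ _)
      _ < ε := by linarith [h1 n, hN n hn]
  have hAlim : ∀ x y, (x, y) ∈ D → Tendsto (fun n => A n x) atTop (𝓝 (-y)) := by
    intro x y hxy
    simp only [hAJ x y hxy]
    exact (hJlim y).neg
  have hcau : ∀ t, 0 ≤ t → ∀ x, CauchySeq fun n => T n t x := by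
    intro t ht
    refine cauchySeq_of_dense (fun n => hT1 n t ht) hD.dense_domain ?_
    rintro x ⟨y, hxy⟩
    have hc := (hAlim x y hxy).cauchySeq
    rw [Metric.cauchySeq_iff] at hc ⊢
    intro ε hε
    obtain ⟨N, hN⟩ := hc (ε / (t + 1)) (by positivity)
    refine ⟨N, fun m hm n hn => ?_⟩
    rw [dist_eq_norm]
    refine (norm_exp_smul_sub_exp_smul_le (hcomm m n) (fun s hs => hT1 m s hs)
      (fun s hs => hT1 n s hs) x ht).trans_lt ?_
    have h1 := hN m hm n hn
    rw [dist_eq_norm, lt_div_iff₀ (by positivity)] at h1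
    nlinarith [norm_nonneg (A m x - A n x)]
  choose Sf hSf using fun t : ℝ≥0 => fun x : H => cauchySeq_tendsto_of_complete (hcau t t.2 x)
  have hSf1 : ∀ t x, ‖Sf t x‖ ≤ 1 * ‖x‖ := fun t x =>
    le_of_tendsto (hSf t x).norm (Eventually.of_forall fun n =>
      (T n t).le_of_opNorm_le (hT1 n t t.2) x)
  let S0 : ℝ≥0 → H →L[ℝ] H := fun t =>
    LinearMap.mkContinuous
      { toFun := Sf t
        map_add' := fun x y => tendsto_nhds_unique (hSf t (x + y)) (by
          simpa only [map_add] using (hSf t x).add (hSf t y))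
        map_smul' := fun c x => tendsto_nhds_unique (hSf t (c • x)) (by
          simpa only [map_smul, RingHom.id_apply] using (hSf t x).const_smul c) } 1 (hSf1 t)
  have hS0 : ∀ (t : ℝ≥0) x, Tendsto (fun n => T n t x) atTop (𝓝 (S0 t x)) := hSf
  have hS1 : ∀ t, ‖S0 t‖ ≤ 1 := fun t => LinearMap.mkContinuous_norm_le _ zero_le_one _
  have hS1' : ∀ t x, ‖S0 t x‖ ≤ ‖x‖ := fun t x => by
    simpa using (S0 t).le_of_opNorm_le (hS1 t) x
  have hSD : ∀ x y, (x, y) ∈ D → ∀ t, ‖S0 t x - x‖ ≤ ‖y‖ * t := by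
    intro x y hxy t
    refine le_of_tendsto ((hS0 t x).sub_const x).norm (Eventually.of_forall fun n => ?_)
    refine (norm_exp_smul_sub_le (fun s hs => hT1 n s hs) x t.2).trans ?_
    rw [hAJ x y hxy, norm_neg]
    have := (J n).le_of_opNorm_le (hJ1 n) y
    rw [one_mul] at this
    exact mul_le_mul_of_nonneg_right this t.2
  have hcoe : Tendsto (fun t : ℝ≥0 => (t : ℝ)) (𝓝[>] 0) (𝓝 0) := by
    have : Tendsto (fun t : ℝ≥0 => (t : ℝ)) (𝓝 0) (𝓝 ((0 : ℝ≥0) : ℝ)) :=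
      NNReal.continuous_coe.tendsto 0
    exact this.mono_left nhdsWithin_le_nhds
  have hSlim : ∀ x, Tendsto (fun t => S0 t x) (𝓝[>] 0) (𝓝 x) := by
    intro x
    rw [Metric.tendsto_nhds]
    intro ε hε
    obtain ⟨z, hz, w, hzw⟩ := Metric.dense_iff.1 hD.dense_domain x (ε / 3) (by positivity)
    have hzy : ‖x - z‖ < ε / 3 := by
      rw [← dist_eq_norm, dist_comm]; exact Metric.mem_ball.1 hz
    have h1 : Tendsto (fun t : ℝ≥0 => ‖w‖ * (t : ℝ)) (𝓝[>] 0) (𝓝 0) := by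
      simpa using hcoe.const_mul ‖w‖
    filter_upwards [h1.eventually (gt_mem_nhds (show (0 : ℝ) < ε / 3 by positivity))] with t ht
    rw [dist_eq_norm]
    have h3 : S0 t x - x = S0 t (x - z) + (S0 t z - z) - (x - z) := by
      rw [map_sub]; abel
    rw [h3]
    calc _ ≤ ‖S0 t (x - z)‖ + ‖S0 t z - z‖ + ‖x - z‖ :=
          (norm_sub_le _ _).trans (by gcongr; exact norm_add_le _ _)
      _ < ε := by linarith [hS1' t (x - z), hSD z w hzw t]
  let _ : NormedAlgebra ℚ (H →L[ℝ] H) := NormedAlgebra.restrictScalars ℚ ℝ _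
  let S : C0Semigroup H :=
    { op := S0
      op_zero := by
        refine ContinuousLinearMap.ext fun x => tendsto_nhds_unique (hS0 0 x) ?_
        simp [T]
      op_add := by
        intro s t
        refine ContinuousLinearMap.ext fun x => tendsto_nhds_unique (hS0 (s + t) x) ?_
        have hadd' : ∀ n, T n ((s + t : ℝ≥0) : ℝ) x = T n s (T n t x) := by
          intro n
          simp only [T, NNReal.coe_add, add_smul]
          rw [NormedSpace.exp_add_of_commute (((Commute.refl (A n)).smul_left _).smul_right _)]
          rfl
        simp only [hadd']
        have h1 : Tendsto (fun n => T n s (T n t x - S0 t x)) atTop (𝓝 0) := by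
          refine squeeze_zero_norm (fun n => (T n s).le_of_opNorm_le (hT1 n s s.2) _) ?_
          simpa using ((hS0 t x).sub_const (S0 t x)).norm
        have h2 := h1.add (hS0 s (S0 t x))
        simpa using h2
      tendsto_zero := hSlim }
  have hgen : ∀ x y, (x, y) ∈ D → (x, -y) ∈ S.generatorGraph := by
    intro x y hxy
    -- Since y need not lie in the domain, -y is approximated by some z in it, which T n s moves by
    -- at most ‖w‖ s. The bound is t times a quantity that becomes small when first z and then t is
    -- chosen.
    have hbound : ∀ z w, (z, w) ∈ D → ∀ t : ℝ≥0,
        ‖S0 t x - x - (t : ℝ) • (-y)‖ ≤ (2 * ‖-y - z‖ + ‖w‖ * t) * t := by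
      intro z w hzw t
      have hl : Tendsto (fun n => T n t x - x - (t : ℝ) • (-y)) atTop
          (𝓝 (S0 t x - x - (t : ℝ) • (-y))) := ((hS0 t x).sub_const x).sub_const _
      have hr : Tendsto (fun n => (‖A n x - -y‖ + 2 * ‖-y - z‖ + ‖w‖ * t) * (t : ℝ)) atTop
          (𝓝 ((2 * ‖-y - z‖ + ‖w‖ * t) * t)) := by
        have h1 := (((hAlim x y hxy).sub_const (-y)).norm.add_const (2 * ‖-y - z‖ + ‖w‖ * t)).mul_const
          (t : ℝ)
        simpa [add_assoc] using h1
      refine le_of_tendsto_of_tendsto hl.norm hr (Eventually.of_forall fun n => ?_)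
      refine norm_exp_smul_sub_sub_le (A n) x (-y) t.2 fun s hs hst => ?_
      have e1 : NormedSpace.exp (s • A n) (A n x) - -y
          = T n s (A n x - -y) + T n s (-y - z) + (T n s z - z) - (-y - z) := by
        simp only [map_sub, T]; abel
      rw [e1]
      have b1 := (T n s).le_of_opNorm_le (hT1 n s hs) (A n x - -y)
      have b2 := (T n s).le_of_opNorm_le (hT1 n s hs) (-y - z)
      have b3 := norm_exp_smul_sub_le (fun s hs => hT1 n s hs) z hs
      have b4 : ‖A n z‖ * s ≤ ‖w‖ * t := by
        have := (J n).le_of_opNorm_le (hJ1 n) w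
        rw [hAJ z w hzw, norm_neg]
        rw [one_mul] at this
        gcongr
      calc _ ≤ ‖T n s (A n x - -y)‖ + ‖T n s (-y - z)‖ + ‖T n s z - z‖ + ‖-y - z‖ :=
            (norm_sub_le _ _).trans (by gcongr; exact norm_add₃_le)
        _ ≤ _ := by simp only [T] at b1 b2 ⊢; linarith
    change Tendsto _ _ _
    rw [Metric.tendsto_nhds]
    intro ε hε
    obtain ⟨z, hz, w, hzw⟩ := Metric.dense_iff.1 hD.dense_domain (-y) (ε / 4) (by positivity)
    have hzy : ‖-y - z‖ < ε / 4 := by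
      rw [← dist_eq_norm, dist_comm]; exact Metric.mem_ball.1 hz
    have h1 : Tendsto (fun t : ℝ≥0 => ‖w‖ * (t : ℝ)) (𝓝[>] 0) (𝓝 0) := by
      simpa using hcoe.const_mul ‖w‖
    filter_upwards [h1.eventually (gt_mem_nhds (show (0 : ℝ) < ε / 3 by positivity)),
      self_mem_nhdsWithin] with t ht ht0
    have ht0' : (0 : ℝ) < t := ht0
    have e2 : (t : ℝ)⁻¹ • (S0 t x - x) - (-y) = (t : ℝ)⁻¹ • (S0 t x - x - (t : ℝ) • (-y)) := by
      rw [smul_sub _ _ ((t : ℝ) • (-y)), smul_smul, inv_mul_cancel₀ ht0'.ne', one_smul]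
    rw [dist_eq_norm]
    change ‖(t : ℝ)⁻¹ • (S0 t x - x) - (-y)‖ < ε
    rw [e2, norm_smul, norm_inv, Real.norm_eq_abs, abs_of_pos ht0', inv_mul_lt_iff₀ ht0']
    nlinarith [hbound z w hzw t]
  refine ⟨S, ?_, hS1, ?_, ?_⟩
  · ext ⟨x, y⟩
    constructor
    · intro hxy
      change (x, -y) ∈ D
      -- Maximality: with z + Dz containing x - y, the vector x - z satisfies B(x - z) = x - z for
      -- the generator B. A contraction semigroup has a dissipative generator, so x = z.
      obtain ⟨z, hz⟩ := hD.exists_mem 1 one_pos (x - y)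
      have h1 := hgen _ _ hz
      have h2 : Tendsto (fun t : ℝ≥0 => (t : ℝ)⁻¹ • (S.op t (x - z) - (x - z))) (𝓝[>] 0)
          (𝓝 (x - z)) := by
        have h3 := Tendsto.sub (f := fun t : ℝ≥0 => (t : ℝ)⁻¹ • (S.op t x - x)) hxy h1
        have h4 : y - -(x - y - (1 : ℝ) • z) = x - z := by rw [one_smul]; abel
        simp only [h4] at h3
        refine h3.congr fun t => ?_
        rw [map_sub, ← smul_sub]
        congr 1
        abel
      have h5 : Tendsto (fun t : ℝ≥0 => ⟪(t : ℝ)⁻¹ • (S.op t (x - z) - (x - z)), x - z⟫_ℝ) (𝓝[>] 0)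
          (𝓝 ⟪x - z, x - z⟫_ℝ) := h2.inner tendsto_const_nhds
      have h6 : ⟪x - z, x - z⟫_ℝ ≤ 0 := by
        refine le_of_tendsto h5 (Eventually.of_forall fun t => ?_)
        rw [real_inner_smul_left, inner_sub_left, real_inner_self_eq_norm_sq]
        refine mul_nonpos_of_nonneg_of_nonpos (inv_nonneg.2 t.2) ?_
        have := real_inner_le_norm (S.op t (x - z)) (x - z)
        have h7 : ‖S.op t (x - z)‖ ≤ ‖x - z‖ := hS1' t (x - z)
        nlinarith [norm_nonneg (x - z)]
      have h7 : x - z = 0 := by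
        rw [real_inner_self_eq_norm_sq] at h6
        exact norm_eq_zero.1 (pow_eq_zero_iff two_ne_zero |>.1 (le_antisymm h6 (sq_nonneg _)))
      rw [← sub_eq_zero.1 h7] at hz
      convert hz using 2
      rw [one_smul]; abel
    · intro hxy
      simpa using hgen x (-y) hxy
  · intro t x hx
    refine hK.mem_of_tendsto (hS0 t x) (Eventually.of_forall fun n => ?_)
    simp only [T, hTsmul]
    exact exp_smul_sub_one_mem hK h0 hadd hsmul (fun f hf => hres _ (hlam n) f hf _ (hJ2 n f))
      (mul_nonneg t.2 (hlam n).le) hx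
  · intro x hx t
    have := hSD x 0 hx t
    rw [norm_zero, zero_mul] at this
    exact sub_eq_zero.1 (norm_le_zero_iff.1 this)

end Generation
-- Regularity of orbits and uniqueness of the semigroup.
section Uniqueness

open scoped InnerProductSpace

namespace C0Semigroup

variable {H : Type*} [NormedAddCommGroup H]

lemma tendsto_nhds_zero [NormedSpace ℝ H] (S : C0Semigroup H) (x : H) :
    Tendsto (fun t => S.op t x) (𝓝 0) (𝓝 x) := by
  have h : (𝓝 (0 : ℝ≥0)) = pure 0 ⊔ 𝓝[>] 0 := by
    have : Ioi (0 : ℝ≥0) = {0}ᶜ := by ext t; simp [pos_iff_ne_zero]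
    rw [this, sup_comm, nhdsNE_sup_pure]
  rw [h]
  refine Tendsto.sup ?_ (S.tendsto_zero x)
  rw [tendsto_pure_left]
  intro s hs
  rw [S.op_zero]
  exact mem_of_mem_nhds hs

/-- Otherwise some t n → 0 has ‖S.op (t n)‖ > n, although these operators converge pointwise; this
contradicts Banach–Steinhaus. -/
lemma exists_bound_near_zero [NormedSpace ℝ H] [CompleteSpace H] (S : C0Semigroup H) :
    ∃ δ : ℝ≥0, 0 < δ ∧ ∃ M : ℝ, ∀ t ≤ δ, ‖S.op t‖ ≤ M := by
  by_contra! hc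
  have h1 : ∀ n : ℕ, ∃ t : ℝ≥0, t ≤ 1 / ((n : ℝ≥0) + 1) ∧ (n : ℝ) < ‖S.op t‖ := fun n =>
    hc _ (by positivity) n
  choose t ht hnt using h1
  have ht0 : Tendsto t atTop (𝓝 0) :=
    tendsto_of_tendsto_of_tendsto_of_le_of_le tendsto_const_nhds
      (NNReal.tendsto_coe.1 (by simpa using tendsto_one_div_add_atTop_nhds_zero_nat (𝕜 := ℝ)))
      (fun _ => zero_le) ht
  obtain ⟨C, hC⟩ := banach_steinhaus (g := fun n => S.op (t n)) fun x => by
    obtain ⟨C, hC⟩ := (((S.tendsto_nhds_zero x).comp ht0).norm).bddAbove_range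
    exact ⟨C, fun n => hC ⟨n, rfl⟩⟩
  obtain ⟨n, hn⟩ := exists_nat_gt C
  exact absurd (hC n) (not_le.2 (hn.trans (hnt n)))

lemma exists_bound [NormedSpace ℝ H] [CompleteSpace H] (S : C0Semigroup H) (T : ℝ≥0) :
    ∃ M : ℝ, ∀ t ≤ T, ‖S.op t‖ ≤ M := by
  obtain ⟨δ, hδ, M, hM⟩ := S.exists_bound_near_zero
  have hM0 : 0 ≤ M := (norm_nonneg _).trans (hM 0 zero_le)
  have key : ∀ n : ℕ, ∃ C : ℝ, ∀ t ≤ n * δ, ‖S.op t‖ ≤ C := by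
    intro n
    induction n with
    | zero => exact ⟨M, fun t ht => hM t (by
        rw [Nat.cast_zero, zero_mul] at ht; exact ht.trans zero_le)⟩
    | succ n ih =>
      obtain ⟨C, hC⟩ := ih
      refine ⟨max M (M * C), fun t ht => ?_⟩
      rcases le_total t δ with h | h
      · exact (hM t h).trans (le_max_left _ _)
      · refine le_trans ?_ (le_max_right _ _)
        have h2 : t - δ ≤ n * δ := by
          rw [tsub_le_iff_right]
          push_cast at ht
          rwa [add_mul, one_mul] at ht
        rw [← add_tsub_cancel_of_le h, S.op_add]
        exact (ContinuousLinearMap.opNorm_comp_le _ _).trans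
          (mul_le_mul (hM _ le_rfl) (hC _ h2) (norm_nonneg _) hM0)
  obtain ⟨n, hn⟩ := exists_nat_ge (T / δ)
  obtain ⟨C, hC⟩ := key n
  exact ⟨C, fun t ht => hC t (ht.trans ((div_le_iff₀ hδ).1 hn))⟩

lemma op_add_apply [NormedSpace ℝ H] (S : C0Semigroup H) (s t : ℝ≥0) (x : H) :
    S.op (s + t) x = S.op s (S.op t x) := by
  rw [S.op_add]; rfl

/-- For s ≤ t the increment is S_s(S_(t-s)x - x). With a local bound on ‖S_s‖, continuity at 0
therefore gives continuity from both sides. -/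
lemma continuous_op [NormedSpace ℝ H] [CompleteSpace H] (S : C0Semigroup H) (x : H) :
    Continuous fun t => S.op t x := by
  have key : ∀ T : ℝ≥0, ∃ M : ℝ, 0 < M ∧ ∀ s t : ℝ≥0, s ≤ T → s ≤ t →
      ‖S.op t x - S.op s x‖ ≤ M * ‖S.op (t - s) x - x‖ := by
    intro T
    obtain ⟨M, hM⟩ := S.exists_bound T
    refine ⟨|M| + 1, by positivity, fun s t hs hst => ?_⟩
    have : S.op t x - S.op s x = S.op s (S.op (t - s) x - x) := by
      rw [map_sub, ← op_add_apply, add_tsub_cancel_of_le hst]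
    rw [this]
    refine (S.op s).le_of_opNorm_le ((hM s hs).trans ?_) _
    linarith [le_abs_self M]
  rw [continuous_iff_continuousAt]
  intro t
  rw [Metric.continuousAt_iff]
  intro ε hε
  obtain ⟨M, hM, hMb⟩ := key (t + 1)
  obtain ⟨δ, hδ, hδb⟩ := Metric.tendsto_nhds_nhds.1 (S.tendsto_nhds_zero x) (ε / M) (by positivity)
  refine ⟨min δ 1, by positivity, fun {s} hs => ?_⟩
  rw [NNReal.dist_eq, lt_min_iff] at hs
  have aux : ∀ a b : ℝ≥0, a ≤ t + 1 → a ≤ b → |(b : ℝ) - a| < δ → ‖S.op b x - S.op a x‖ < ε := by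
    intro a b ha hab hd
    have h1 : dist (b - a) 0 < δ := by
      rw [NNReal.dist_eq, NNReal.coe_sub hab]; simpa using hd
    have h2 := hδb h1
    rw [dist_eq_norm, lt_div_iff₀ hM, mul_comm] at h2
    exact (hMb a b ha hab).trans_lt h2
  rw [dist_eq_norm]
  rcases le_total s t with h | h
  · rw [norm_sub_rev]
    exact aux s t (h.trans (by simp)) h (by rw [abs_sub_comm]; exact hs.1)
  · exact aux t s (by simp) h hs.1

lemma op_mem_generatorGraph [NormedSpace ℝ H] (S : C0Semigroup H) {x y : H}
    (h : (x, y) ∈ S.generatorGraph) (t : ℝ≥0) : (S.op t x, S.op t y) ∈ S.generatorGraph := by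
  have h1 := ((S.op t).continuous.tendsto y).comp h
  refine Tendsto.congr (fun s => ?_) h1
  simp only [Function.comp_apply]
  rw [map_smul, map_sub, ← op_add_apply, ← op_add_apply, add_comm]

/-- Applying S_t to the difference quotient at 0 yields a right derivative, which is all that
`nonpos_of_deriv_nonpos` requires. -/
lemma hasDerivWithinAt_op [NormedSpace ℝ H] (S : C0Semigroup H) {x y : H}
    (h : (x, y) ∈ S.generatorGraph) {t : ℝ} (ht : 0 ≤ t) :
    HasDerivWithinAt (fun s : ℝ => S.op s.toNNReal x) (S.op t.toNNReal y) (Ici t) t := by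
  rw [← hasDerivWithinAt_Ioi_iff_Ici, hasDerivWithinAt_iff_tendsto_slope' (by simp)]
  have h1 : Tendsto (fun s : ℝ => (s - t).toNNReal) (𝓝[>] t) (𝓝[>] 0) := by
    refine tendsto_nhdsWithin_iff.2 ⟨?_, ?_⟩
    · have : Tendsto (fun s : ℝ => (s - t).toNNReal) (𝓝 t) (𝓝 (t - t).toNNReal) :=
        (continuous_real_toNNReal.comp (continuous_id.sub continuous_const)).tendsto t
      simpa using this.mono_left nhdsWithin_le_nhds
    · filter_upwards [self_mem_nhdsWithin] with s hs
      exact Real.toNNReal_pos.2 (sub_pos.2 hs)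
  have h2 := ((S.op t.toNNReal).continuous.tendsto y).comp (Tendsto.comp h h1)
  refine h2.congr' ?_
  filter_upwards [self_mem_nhdsWithin] with s hs
  have hs' : t < s := hs
  have h3 : s.toNNReal = t.toNNReal + (s - t).toNNReal := by
    rw [← Real.toNNReal_add ht (sub_nonneg.2 hs'.le), add_sub_cancel]
  simp only [Function.comp_apply, slope, vsub_eq_sub]
  rw [h3, op_add_apply, map_smul, map_sub, Real.coe_toNNReal _ (sub_nonneg.2 hs'.le)]

lemma nonpos_of_deriv_nonpos {g g' : ℝ → ℝ} (hg : Continuous g) (h0 : g 0 ≤ 0)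
    (hd : ∀ s, 0 ≤ s → HasDerivWithinAt g (g' s) (Ici s) s) (hg' : ∀ s, g' s ≤ 0) {t : ℝ}
    (ht : 0 ≤ t) : g t ≤ 0 :=
  image_le_of_liminf_slope_right_le_deriv_boundary (B := fun _ => 0) (B' := fun _ => 0)
    hg.continuousOn h0 continuousOn_const (fun _ _ => hasDerivWithinAt_const _ _ _)
    (fun s hs _ hr => (hd s hs.1).liminf_right_slope_le ((hg' s).trans_lt hr)) ⟨ht, le_rfl⟩

/-- A C₀-semigroup generated by the negative of a maximal monotone relation is unique. -/
theorem eq_of_generatorGraph [InnerProductSpace ℝ H] [CompleteSpace H] {D : Submodule ℝ (H × H)}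
    (hD : IsMaximalMonotone D) {S S' : C0Semigroup H}
    (hS : S.generatorGraph = {p | (p.1, -p.2) ∈ D})
    (hS' : S'.generatorGraph = {p | (p.1, -p.2) ∈ D}) : S = S' := by
  have key : ∀ x y, (x, y) ∈ D → ∀ t : ℝ≥0, S.op t x = S'.op t x := by
    intro x y hxy t
    have h1 : (x, -y) ∈ S.generatorGraph := by rw [hS]; simpa using hxy
    have h2 : (x, -y) ∈ S'.generatorGraph := by rw [hS']; simpa using hxy
    let f : ℝ → H := fun s => S.op s.toNNReal x - S'.op s.toNNReal x
    let f' : ℝ → H := fun s => S.op s.toNNReal (-y) - S'.op s.toNNReal (-y)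
    have hf : ∀ s, 0 ≤ s → HasDerivWithinAt f (f' s) (Ici s) s := fun s hs =>
      (S.hasDerivWithinAt_op h1 hs).sub (S'.hasDerivWithinAt_op h2 hs)
    have hfc : Continuous f := by
      exact ((S.continuous_op x).comp continuous_real_toNNReal).sub
        ((S'.continuous_op x).comp continuous_real_toNNReal)
    -- Both orbits stay in the domain, and D is linear, so monotonicity applies to their difference
    -- and makes ‖f‖² nonincreasing.
    have hneg : ∀ s, ⟪f s, f' s⟫_ℝ ≤ 0 := by
      intro s
      have a1 := S.op_mem_generatorGraph h1 s.toNNReal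
      have a2 := S'.op_mem_generatorGraph h2 s.toNNReal
      rw [hS] at a1
      rw [hS'] at a2
      have a3 := hD.inner_nonneg _ (D.sub_mem a1 a2)
      have a4 : -(S.op s.toNNReal (-y)) - -(S'.op s.toNNReal (-y)) = - f' s := by
        simp only [f']; abel
      simp only [Prod.mk_sub_mk, a4, inner_neg_right] at a3
      exact neg_nonneg.1 a3
    have hsq : ∀ s, 0 ≤ s → HasDerivWithinAt (fun r => ‖f r‖ ^ 2) (2 * ⟪f s, f' s⟫_ℝ) (Ici s) s :=
      fun s hs => (hf s hs).norm_sq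
    have hf0 : ‖f 0‖ ^ 2 ≤ 0 := by simp [f, S.op_zero, S'.op_zero]
    have hz : ‖f t‖ ^ 2 ≤ 0 := nonpos_of_deriv_nonpos (hfc.norm.pow 2) hf0 hsq
      (fun s => by linarith [hneg s]) t.2
    have h3 : ‖f t‖ = 0 := pow_eq_zero_iff two_ne_zero |>.1 (le_antisymm hz (sq_nonneg _))
    have h4 := sub_eq_zero.1 (norm_eq_zero.1 h3)
    simpa using h4
  have hop : S.op = S'.op := by
    funext t
    refine ContinuousLinearMap.ext fun x => ?_
    refine congrFun (Continuous.ext_on hD.dense_domain (S.op t).continuous (S'.op t).continuous ?_) x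
    rintro z ⟨w, hzw⟩
    exact key z w hzw t
  cases S
  cases S'
  simpa using hop

end C0Semigroup

end Uniqueness
-- Weak gradients along segments.
section Translation

variable {d : ℕ}

open scoped InnerProductSpace

lemma integrable_comp_add_smul {g : EuclideanSpace ℝ (Fin d) → ℝ} (hg : StronglyMeasurable g)
    (hi : Integrable g) (w : EuclideanSpace ℝ (Fin d)) :
    Integrable (fun p : EuclideanSpace ℝ (Fin d) × ℝ => g (p.1 + p.2 • w))
      (volume.prod (volume.restrict (Ioc (0 : ℝ) 1))) := by
  have hm : StronglyMeasurable (fun p : EuclideanSpace ℝ (Fin d) × ℝ => g (p.1 + p.2 • w)) :=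
    hg.comp_measurable (by fun_prop)
  rw [integrable_prod_iff' hm.aestronglyMeasurable]
  refine ⟨Eventually.of_forall fun θ => hi.comp_add_right (θ • w), ?_⟩
  have : ∀ θ : ℝ, ∫ x, ‖g (x + θ • w)‖ = ∫ x, ‖g x‖ := fun θ =>
    integral_add_right_eq_self (fun x => ‖g x‖) (θ • w)
  simp only [this]
  exact integrable_const _

/-- Fubini's theorem combined with translation invariance. -/
lemma integral_mul_integral_comp_add {ψ g : EuclideanSpace ℝ (Fin d) → ℝ} (hψ : Measurable ψ)
    {C : ℝ} (hb : ∀ x, ‖ψ x‖ ≤ C) (hg : StronglyMeasurable g) (hi : Integrable g)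
    (w : EuclideanSpace ℝ (Fin d)) :
    ∫ x, ψ x * ∫ θ in (0 : ℝ)..1, g (x + θ • w)
      = ∫ x, (∫ θ in (0 : ℝ)..1, ψ (x - θ • w)) * g x := by
  have h1 : Integrable (fun p : EuclideanSpace ℝ (Fin d) × ℝ => ψ p.1 * g (p.1 + p.2 • w))
      (volume.prod (volume.restrict (Ioc (0 : ℝ) 1))) :=
    (integrable_comp_add_smul hg hi w).bdd_mul (c := C)
      (hψ.comp measurable_fst).aestronglyMeasurable (Eventually.of_forall fun p => hb p.1)
  have h2 : Integrable (fun p : EuclideanSpace ℝ (Fin d) × ℝ => ψ (p.1 - p.2 • w) * g p.1)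
      (volume.prod (volume.restrict (Ioc (0 : ℝ) 1))) :=
    (hi.comp_fst _).bdd_mul (c := C)
      (hψ.comp (by fun_prop)).aestronglyMeasurable (Eventually.of_forall fun p => hb _)
  simp only [intervalIntegral.integral_of_le zero_le_one]
  simp_rw [← integral_const_mul, ← integral_mul_const]
  rw [integral_integral_swap h1,
    integral_integral_swap (f := fun x (θ : ℝ) => ψ (x - θ • w) * g x) h2]
  congr 1
  ext θ
  rw [← integral_add_right_eq_self (fun x => ψ (x - θ • w) * g x) (θ • w)]
  simp

/-- The points `x` for which the segment from `x` to `x + w` is contained in `Ω`. -/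
def segmentSet (Ω : Set (EuclideanSpace ℝ (Fin d))) (w : EuclideanSpace ℝ (Fin d)) :
    Set (EuclideanSpace ℝ (Fin d)) :=
  {x | ∀ θ ∈ Icc (0 : ℝ) 1, x + θ • w ∈ Ω}

lemma isOpen_segmentSet {Ω : Set (EuclideanSpace ℝ (Fin d))} (hΩ : IsOpen Ω)
    (w : EuclideanSpace ℝ (Fin d)) : IsOpen (segmentSet Ω w) := by
  rw [isOpen_iff_eventually]
  intro x hx
  refine isCompact_Icc.eventually_forall_of_forall_eventually fun θ hθ => ?_
  have hc : Continuous fun z : EuclideanSpace ℝ (Fin d) × ℝ => z.1 + z.2 • w := by fun_prop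
  exact hc.continuousAt.eventually (hΩ.mem_nhds (hx θ hθ))

/-- The average of `φ` over the segment from `x - w` to `x`. -/
def segmentAverage (φ : EuclideanSpace ℝ (Fin d) → ℝ) (w x : EuclideanSpace ℝ (Fin d)) : ℝ :=
  ∫ θ in (0 : ℝ)..1, φ (x - θ • w)

/-- The average is the convolution of φ with the image of Lebesgue measure on (0, 1] under θ ↦ θw.
-/
lemma contDiff_segmentAverage {φ : EuclideanSpace ℝ (Fin d) → ℝ} (hφ : ContDiff ℝ ∞ φ)
    (hs : HasCompactSupport φ) (w : EuclideanSpace ℝ (Fin d)) :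
    ContDiff ℝ ∞ (segmentAverage φ w) := by
  let μ : Measure (EuclideanSpace ℝ (Fin d)) :=
    (volume.restrict (Ioc (0 : ℝ) 1)).map (fun θ => θ • w)
  have hmeas : Measurable fun θ : ℝ => θ • w := by fun_prop
  have : IsFiniteMeasure μ := Measure.isFiniteMeasure_map _ _
  have h := hs.contDiff_convolution_right (ContinuousLinearMap.lsmul ℝ ℝ) (μ := μ) (n := ⊤)
    (f := fun _ => (1 : ℝ)) (integrable_const _).locallyIntegrable hφ
  convert h using 1
  ext x
  rw [segmentAverage, intervalIntegral.integral_of_le zero_le_one, convolution_def,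
    integral_map hmeas.aemeasurable]
  · simp
  · have hc : Continuous fun t => φ (x - t) := hφ.continuous.comp (by fun_prop)
    simpa using hc.aestronglyMeasurable

/-- The support lies in the union of the segments from y to y + w with y in the support of φ, a
compact set contained in Ω. -/
lemma IsTestFunction.segmentAverage {Ω : Set (EuclideanSpace ℝ (Fin d))}
    {φ : EuclideanSpace ℝ (Fin d) → ℝ} {w : EuclideanSpace ℝ (Fin d)}
    (hφ : IsTestFunction (segmentSet Ω w) φ) : IsTestFunction Ω (segmentAverage φ w) := by
  let K : Set (EuclideanSpace ℝ (Fin d)) :=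
    (fun p : EuclideanSpace ℝ (Fin d) × ℝ => p.1 + p.2 • w) '' (tsupport φ ×ˢ Icc (0 : ℝ) 1)
  have hK : IsCompact K := (hφ.hasCompactSupport.prod isCompact_Icc).image (by fun_prop)
  have hsub : Function.support (DirichletNeumann.segmentAverage φ w) ⊆ K := by
    intro x hx
    by_contra hxK
    refine hx ?_
    rw [DirichletNeumann.segmentAverage]
    refine intervalIntegral.integral_zero_ae (Eventually.of_forall fun θ hθ => ?_)
    rw [uIoc_of_le zero_le_one] at hθ
    by_contra h0
    exact hxK ⟨(x - θ • w, θ), ⟨subset_tsupport _ h0, Ioc_subset_Icc_self hθ⟩, by simp⟩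
  have hts : tsupport (DirichletNeumann.segmentAverage φ w) ⊆ K :=
    closure_minimal hsub hK.isClosed
  refine ⟨contDiff_segmentAverage hφ.contDiff hφ.hasCompactSupport w,
    hK.of_isClosed_subset (isClosed_tsupport _) hts, hts.trans ?_⟩
  rintro _ ⟨⟨y, θ⟩, ⟨hy, hθ⟩, rfl⟩
  exact hφ.tsupport_subset hy θ hθ

/-- At x + s w the average is the integral of r ↦ φ(x + r w) over [s - 1, s]; differentiating in s
leaves the two endpoint values. -/
lemma fderiv_segmentAverage {φ : EuclideanSpace ℝ (Fin d) → ℝ} (hφ : ContDiff ℝ ∞ φ)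
    (hs : HasCompactSupport φ) (w x : EuclideanSpace ℝ (Fin d)) :
    fderiv ℝ (segmentAverage φ w) x w = φ x - φ (x - w) := by
  have h1 : HasDerivAt (fun s : ℝ => segmentAverage φ w (x + s • w))
      (fderiv ℝ (segmentAverage φ w) x w) 0 := by
    have hd : HasFDerivAt (segmentAverage φ w) (fderiv ℝ (segmentAverage φ w) x)
        (x + (0 : ℝ) • w) := by
      rw [zero_smul, add_zero]
      exact ((contDiff_segmentAverage hφ hs w).differentiable (by simp)).differentiableAt.hasFDerivAt
    refine hd.comp_hasDerivAt (f := fun s : ℝ => x + s • w) (0 : ℝ) ?_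
    simpa using ((hasDerivAt_id (0 : ℝ)).smul_const w).const_add x
  have hcont : Continuous fun r : ℝ => φ (x + r • w) :=
    hφ.continuous.comp (by fun_prop)
  have e : ∀ s : ℝ, segmentAverage φ w (x + s • w)
      = (∫ r in (0 : ℝ)..s, φ (x + r • w)) - ∫ r in (0 : ℝ)..(s - 1), φ (x + r • w) := by
    intro s
    rw [intervalIntegral.integral_interval_sub_left (hcont.intervalIntegrable _ _)
      (hcont.intervalIntegrable _ _), segmentAverage]
    have := intervalIntegral.integral_comp_sub_left (a := 0) (b := 1)
      (fun r : ℝ => φ (x + r • w)) s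
    rw [sub_zero] at this
    rw [← this]
    congr 1
    ext θ
    congr 1
    module
  have h2 : HasDerivAt (fun s : ℝ => segmentAverage φ w (x + s • w)) (φ x - φ (x - w)) 0 := by
    rw [funext e]
    have a1 : HasDerivAt (fun s : ℝ => ∫ r in (0 : ℝ)..s, φ (x + r • w)) (φ (x + (0 : ℝ) • w)) 0 :=
      hcont.integral_hasStrictDerivAt 0 0 |>.hasDerivAt
    have a2 : HasDerivAt (fun s : ℝ => ∫ r in (0 : ℝ)..(s - 1), φ (x + r • w))
        (φ (x + (-1 : ℝ) • w)) 0 := by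
      have b1 : HasDerivAt (fun s : ℝ => ∫ r in (0 : ℝ)..s, φ (x + r • w))
          (φ (x + (-1 : ℝ) • w)) (0 - 1) := by
        simpa using (hcont.integral_hasStrictDerivAt 0 (-1)).hasDerivAt
      exact b1.comp_sub_const 0 1
    refine (a1.sub a2).congr_deriv ?_
    rw [zero_smul, add_zero, neg_one_smul, ← sub_eq_add_neg]
  exact h1.unique h2

/-- Along almost all segments contained in `Ω` a function is the integral of its weak gradient. -/
theorem HasWeakGradient.ae_sub_eq_integral {Ω : Set (EuclideanSpace ℝ (Fin d))} (hΩ : IsOpen Ω)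
    {u : EuclideanSpace ℝ (Fin d) → ℝ} {G : EuclideanSpace ℝ (Fin d) → EuclideanSpace ℝ (Fin d)}
    (hu : IntegrableOn u Ω) (hGm : StronglyMeasurable G) (hG : IntegrableOn G Ω)
    (h : HasWeakGradient Ω u G) (w : EuclideanSpace ℝ (Fin d)) :
    ∀ᵐ x, x ∈ segmentSet Ω w →
      u (x + w) - u x = ∫ θ in (0 : ℝ)..1, ⟪Ω.indicator G (x + θ • w), w⟫_ℝ := by
  let g : EuclideanSpace ℝ (Fin d) → ℝ := fun x => ⟪Ω.indicator G x, w⟫_ℝ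
  have hgm : StronglyMeasurable g :=
    (hGm.indicator hΩ.measurableSet).inner stronglyMeasurable_const
  have hgi : Integrable g := (hG.integrable_indicator hΩ.measurableSet).inner_const w
  have hui : Integrable (Ω.indicator u) := hu.integrable_indicator hΩ.measurableSet
  have hprod := (integrable_comp_add_smul hgm hgi w).integral_prod_left
  have hI : Integrable fun x => ∫ θ in (0 : ℝ)..1, g (x + θ • w) := by
    simpa only [intervalIntegral.integral_of_le zero_le_one] using hprod
  have hui' : Integrable fun x => Ω.indicator u (x + w) := hui.comp_add_right w
  have hf : Integrable fun x => Ω.indicator u (x + w) - Ω.indicator u x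
      - ∫ θ in (0 : ℝ)..1, g (x + θ • w) := (hui'.sub hui).sub hI
  have key := (isOpen_segmentSet hΩ w).ae_eq_zero_of_integral_contDiff_smul_eq_zero
    (hf.locallyIntegrable.locallyIntegrableOn _) fun φ hφ hφs hφt => by
      have hT : IsTestFunction (segmentSet Ω w) φ := ⟨hφ, hφs, hφt⟩
      obtain ⟨C, hC⟩ := hφ.continuous.bounded_above_of_compact_support hφs
      -- This test function has w-derivative φ(x) - φ(x - w), so the weak gradient identity tests
      -- the increment u(x + w) - u(x) against φ.
      have hw := h _ hT.segmentAverage w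
      simp only [fderiv_segmentAverage hφ hφs] at hw
      have hm {f : EuclideanSpace ℝ (Fin d) → ℝ} (hf : Integrable f) :
          Integrable fun x => φ x * f x :=
        hf.bdd_mul (c := C) hφ.continuous.aestronglyMeasurable (Eventually.of_forall hC)
      have hm' : Integrable fun x => φ (x - w) * Ω.indicator u x :=
        hui.bdd_mul (c := C) (hφ.continuous.comp (by fun_prop)).aestronglyMeasurable
          (Eventually.of_forall fun _ => hC _)
      have e1 : ∫ x, φ x * Ω.indicator u (x + w) = ∫ x, φ (x - w) * Ω.indicator u x := by
        rw [← integral_add_right_eq_self (fun x => φ (x - w) * Ω.indicator u x) w]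
        simp
      have e2 : ∫ x in Ω, u x * (φ x - φ (x - w))
          = (∫ x, φ x * Ω.indicator u x) - ∫ x, φ (x - w) * Ω.indicator u x := by
        rw [← integral_sub (hm hui) hm', ← integral_indicator hΩ.measurableSet]
        congr 1
        ext x
        by_cases hx : x ∈ Ω
        · simp [hx]; ring
        · simp [hx]
      have e3 : ∫ x in Ω, segmentAverage φ w x * ⟪G x, w⟫_ℝ
          = ∫ x, φ x * ∫ θ in (0 : ℝ)..1, g (x + θ • w) := by
        rw [integral_mul_integral_comp_add hφ.continuous.measurable hC hgm hgi w,
          ← integral_indicator hΩ.measurableSet]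
        congr 1
        ext x
        by_cases hx : x ∈ Ω
        · simp [hx, g, segmentAverage]
        · simp [hx, g]
      have hmm : Integrable fun x => φ x * Ω.indicator u (x + w) - φ x * Ω.indicator u x :=
        (hm hui').sub (hm hui)
      simp only [smul_eq_mul, mul_sub]
      rw [integral_sub hmm (hm hI), integral_sub (hm hui') (hm hui), e1, ← e3]
      linarith
  filter_upwards [key] with x hx hxs
  have h0 := hx hxs
  have m0 : x ∈ Ω := by simpa using hxs 0 (by simp)
  have m1 : x + w ∈ Ω := by simpa using hxs 1 (by simp)
  rw [indicator_of_mem m0, indicator_of_mem m1] at h0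
  exact sub_eq_zero.1 h0

end Translation
-- The chain rule for weak gradients.
section ChainRule

variable {d : ℕ}

open scoped InnerProductSpace

/-- The average of `F'` over the segment from `a` to `b`. -/
def meanSlope (F' : ℝ → ℝ) (a b : ℝ) : ℝ := ∫ s in (0 : ℝ)..1, F' (a + s * (b - a))

lemma continuous_meanSlope {F' : ℝ → ℝ} (hF' : Continuous F') :
    Continuous fun p : ℝ × ℝ => meanSlope F' p.1 p.2 := by
  unfold meanSlope
  exact intervalIntegral.continuous_parametric_intervalIntegral_of_continuous' (by fun_prop) _ _

lemma meanSlope_self (F' : ℝ → ℝ) (a : ℝ) : meanSlope F' a a = F' a := by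
  simp [meanSlope]

lemma abs_meanSlope_le {F' : ℝ → ℝ} (hb : ∀ x, |F' x| ≤ 1) (a b : ℝ) : |meanSlope F' a b| ≤ 1 := by
  have := intervalIntegral.norm_integral_le_of_norm_le_const (a := 0) (b := 1) (C := 1)
    (f := fun s : ℝ => F' (a + s * (b - a))) fun s _ => hb _
  simpa [meanSlope] using this

/-- This expresses increments of F without division, so the slope remains continuous on the diagonal
a = b, where the limit is taken. -/
lemma meanSlope_mul {F F' : ℝ → ℝ} (hF : ∀ x, HasDerivAt F (F' x) x) (hF' : Continuous F')
    (a b : ℝ) : meanSlope F' a b * (b - a) = F b - F a := by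
  have h : ∀ s ∈ uIcc (0 : ℝ) 1, HasDerivAt (fun s : ℝ => F (a + s * (b - a)))
      (F' (a + s * (b - a)) * (b - a)) s := by
    intro s _
    refine (hF _).comp s ?_
    simpa using ((hasDerivAt_id s).mul_const (b - a)).const_add a
  have := intervalIntegral.integral_eq_sub_of_hasDerivAt h
    ((by fun_prop : Continuous fun s : ℝ => F' (a + s * (b - a)) * (b - a)).intervalIntegrable _ _)
  rw [meanSlope, ← intervalIntegral.integral_mul_const, this]
  simp

lemma eventually_subset_segmentSet {Ω K : Set (EuclideanSpace ℝ (Fin d))} (hΩ : IsOpen Ω)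
    (hK : IsCompact K) (hKΩ : K ⊆ Ω) (v : EuclideanSpace ℝ (Fin d)) {h : ℕ → ℝ}
    (hh : Tendsto h atTop (𝓝 0)) : ∀ᶠ n in atTop, K ⊆ segmentSet Ω (h n • v) := by
  obtain ⟨δ, hδ, hsub⟩ := hK.exists_thickening_subset_open hΩ hKΩ
  have h1 : Tendsto (fun n => ‖h n • v‖) atTop (𝓝 0) := by
    simpa using (hh.smul_const v).norm
  filter_upwards [h1.eventually (gt_mem_nhds hδ)] with n hn x hx θ hθ
  refine hsub (Metric.mem_thickening_iff.2 ⟨x, hx, ?_⟩)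
  rw [dist_eq_norm, add_sub_cancel_left, norm_smul, Real.norm_eq_abs, abs_of_nonneg hθ.1]
  exact (mul_le_of_le_one_left (norm_nonneg _) hθ.2).trans_lt hn

/-- The difference quotient of `F ∘ u`, tested against `φ`. -/
lemma HasWeakGradient.integral_diff_comp {Ω : Set (EuclideanSpace ℝ (Fin d))} (hΩ : IsOpen Ω)
    {u : EuclideanSpace ℝ (Fin d) → ℝ} {G : EuclideanSpace ℝ (Fin d) → EuclideanSpace ℝ (Fin d)}
    (hum : Measurable u) (hu : IntegrableOn u Ω)
    (hGm : StronglyMeasurable G) (hG : IntegrableOn G Ω) (hw : HasWeakGradient Ω u G)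
    {F F' : ℝ → ℝ} (hF : ∀ x, HasDerivAt F (F' x) x) (hF' : Continuous F')
    (hb : ∀ x, |F' x| ≤ 1) (hFu : IntegrableOn (fun x => F (u x)) Ω)
    {φ : EuclideanSpace ℝ (Fin d) → ℝ} (hφ : Continuous φ) {C : ℝ} (hC : ∀ x, ‖φ x‖ ≤ C)
    (v : EuclideanSpace ℝ (Fin d)) {h : ℝ} (hh : h ≠ 0) (hK : tsupport φ ⊆ segmentSet Ω (h • v)) :
    ∫ x, (h⁻¹ * (φ (x - h • v) - φ x)) * Ω.indicator (fun x => F (u x)) x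
      = ∫ x, (∫ θ in (0 : ℝ)..1, φ (x - θ • h • v) *
          meanSlope F' (u (x - θ • h • v)) (u (x - θ • h • v + h • v))) *
          ⟪Ω.indicator G x, v⟫_ℝ := by
  let g : EuclideanSpace ℝ (Fin d) → ℝ := fun x => ⟪Ω.indicator G x, v⟫_ℝ
  let ψ : EuclideanSpace ℝ (Fin d) → ℝ := fun x => φ x * meanSlope F' (u x) (u (x + h • v))
  let f : EuclideanSpace ℝ (Fin d) → ℝ := Ω.indicator (fun x => F (u x))
  have hgm : StronglyMeasurable g :=
    (hGm.indicator hΩ.measurableSet).inner stronglyMeasurable_const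
  have hgi : Integrable g := (hG.integrable_indicator hΩ.measurableSet).inner_const v
  have hfi : Integrable f := hFu.integrable_indicator hΩ.measurableSet
  have hψm : Measurable ψ := hφ.measurable.mul
    ((continuous_meanSlope hF').measurable.comp
      (hum.prodMk (hum.comp (measurable_id.add_const _))))
  have hψb : ∀ x, ‖ψ x‖ ≤ C := by
    intro x
    rw [norm_mul]
    exact (mul_le_of_le_one_right (norm_nonneg _) (abs_meanSlope_le hb _ _)).trans (hC x)
  have e0 := integral_mul_integral_comp_add hψm hψb hgm hgi (h • v)
  change _ = ∫ x, (∫ θ in (0 : ℝ)..1, ψ (x - θ • h • v)) * g x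
  rw [← e0]
  have hi1 : Integrable fun x => φ x * f x :=
    hfi.bdd_mul (c := C) hφ.aestronglyMeasurable (Eventually.of_forall hC)
  have hi2 : Integrable fun x => φ (x - h • v) * f x :=
    hfi.bdd_mul (c := C) (hφ.comp (by fun_prop)).aestronglyMeasurable
      (Eventually.of_forall fun _ => hC _)
  have hi3 : Integrable fun x => φ x * f (x + h • v) :=
    (hfi.comp_add_right (h • v)).bdd_mul (c := C) hφ.aestronglyMeasurable (Eventually.of_forall hC)
  have e1 : ∫ x, φ (x - h • v) * f x = ∫ x, φ x * f (x + h • v) := by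
    rw [← integral_add_right_eq_self (fun x => φ (x - h • v) * f x) (h • v)]
    simp
  have e2 : ∫ x, (h⁻¹ * (φ (x - h • v) - φ x)) * f x
      = ∫ x, h⁻¹ * (φ x * f (x + h • v) - φ x * f x) := by
    have r (x) : (h⁻¹ * (φ (x - h • v) - φ x)) * f x
        = h⁻¹ * (φ (x - h • v) * f x - φ x * f x) := by ring
    simp only [r]
    rw [integral_const_mul, integral_const_mul, integral_sub hi2 hi1, integral_sub hi3 hi1, e1]
  change ∫ x, (h⁻¹ * (φ (x - h • v) - φ x)) * f x = _
  rw [e2]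
  refine integral_congr_ae ?_
  -- After the translation of the difference quotient from φ to F ∘ u, the claim is pointwise: the
  -- increment of F ∘ u is the mean slope times the increment of u, itself h times the average of
  -- ⟪G, v⟫ over the segment.
  filter_upwards [hw.ae_sub_eq_integral hΩ hu hGm hG (h • v)] with x hx
  by_cases hxφ : x ∈ tsupport φ
  · have hxs := hK hxφ
    have m0 : x ∈ Ω := by simpa using hxs 0 (by simp)
    have m1 : x + h • v ∈ Ω := by simpa using hxs 1 (by simp)
    have hx' := hx hxs
    simp only [real_inner_smul_right, intervalIntegral.integral_const_mul] at hx'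
    simp only [ψ, f, indicator_of_mem m0, indicator_of_mem m1]
    have e3 : ∫ θ in (0 : ℝ)..1, g (x + θ • h • v) = h⁻¹ * (u (x + h • v) - u x) := by
      rw [hx', inv_mul_cancel_left₀ hh]
    rw [e3, ← mul_sub, ← meanSlope_mul hF hF' (u x) (u (x + h • v))]
    ring
  · have h0 : φ x = 0 := image_eq_zero_of_notMem_tsupport hxφ
    simp [ψ, h0]

/-- The chain rule for weak gradients. -/
theorem HasWeakGradient.comp {Ω : Set (EuclideanSpace ℝ (Fin d))} (hΩ : IsOpen Ω)
    {u : EuclideanSpace ℝ (Fin d) → ℝ} {G : EuclideanSpace ℝ (Fin d) → EuclideanSpace ℝ (Fin d)}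
    (hum : Measurable u) (huc : ContinuousOn u Ω) (hu : IntegrableOn u Ω)
    (hGm : StronglyMeasurable G) (hG : IntegrableOn G Ω) (hw : HasWeakGradient Ω u G)
    {F F' : ℝ → ℝ} (hF : ∀ x, HasDerivAt F (F' x) x) (hF' : Continuous F')
    (hb : ∀ x, |F' x| ≤ 1) (hFu : IntegrableOn (fun x => F (u x)) Ω) :
    HasWeakGradient Ω (fun x => F (u x)) (fun x => F' (u x) • G x) := by
  intro φ hφ v
  have hφc := hφ.contDiff.continuous
  obtain ⟨C, hC⟩ := hφc.bounded_above_of_compact_support hφ.hasCompactSupport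
  obtain ⟨L, hL⟩ := hφ.contDiff.lipschitzWith_of_hasCompactSupport hφ.hasCompactSupport (by simp)
  let h : ℕ → ℝ := fun n => 1 / ((n : ℝ) + 1)
  have hpos : ∀ n, 0 < h n := fun n => by positivity
  have hlim : Tendsto h atTop (𝓝 0) := tendsto_one_div_add_atTop_nhds_zero_nat
  have hlimv (θ : ℝ) : Tendsto (fun n => θ • h n • v) atTop (𝓝 0) := by
    simpa using (hlim.smul_const v).const_smul θ
  let f : EuclideanSpace ℝ (Fin d) → ℝ := Ω.indicator (fun x => F (u x))
  let g : EuclideanSpace ℝ (Fin d) → ℝ := fun x => ⟪Ω.indicator G x, v⟫_ℝ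
  have hgm : StronglyMeasurable g :=
    (hGm.indicator hΩ.measurableSet).inner stronglyMeasurable_const
  have hgi : Integrable g := (hG.integrable_indicator hΩ.measurableSet).inner_const v
  have hfi : Integrable f := hFu.integrable_indicator hΩ.measurableSet
  let q : ℕ → EuclideanSpace ℝ (Fin d) → ℝ → ℝ := fun n x θ => φ (x - θ • h n • v) *
    meanSlope F' (u (x - θ • h n • v)) (u (x - θ • h n • v + h n • v))
  have hqm : ∀ n, Measurable fun p : EuclideanSpace ℝ (Fin d) × ℝ => q n p.1 p.2 := fun n =>
    (hφc.measurable.comp (by fun_prop)).mul ((continuous_meanSlope hF').measurable.comp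
      ((hum.comp (by fun_prop)).prodMk (hum.comp (by fun_prop))))
  have hqb : ∀ n x θ, ‖q n x θ‖ ≤ C := by
    intro n x θ
    rw [norm_mul]
    exact (mul_le_of_le_one_right (norm_nonneg _) (abs_meanSlope_le hb _ _)).trans (hC _)
  -- Continuity of u on Ω makes both arguments of `meanSlope` converge to u x.
  have hqlim : ∀ x ∈ Ω, ∀ θ, Tendsto (fun n => q n x θ) atTop (𝓝 (φ x * F' (u x))) := by
    intro x hx θ
    have t1 : Tendsto (fun n => x - θ • h n • v) atTop (𝓝 x) := by
      simpa using tendsto_const_nhds.sub (hlimv θ)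
    have t2 : Tendsto (fun n => x - θ • h n • v + h n • v) atTop (𝓝 x) := by
      simpa using t1.add (hlimv 1)
    have hcx : ContinuousAt u x := huc.continuousAt (hΩ.mem_nhds hx)
    have t3 := ((continuous_meanSlope hF').tendsto (u x, u x)).comp
      ((hcx.tendsto.comp t1).prodMk_nhds (hcx.tendsto.comp t2))
    rw [meanSlope_self] at t3
    exact ((hφc.tendsto x).comp t1).mul t3
  have hR : Tendsto (fun n => ∫ x, (∫ θ in (0 : ℝ)..1, q n x θ) * g x) atTop
      (𝓝 (∫ x, φ x * F' (u x) * g x)) := by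
    refine tendsto_integral_of_dominated_convergence (fun x => C * ‖g x‖) (fun n => ?_)
      (hgi.norm.const_mul C) (fun n => Eventually.of_forall fun x => ?_)
      (Eventually.of_forall fun x => ?_)
    · refine AEStronglyMeasurable.mul ?_ hgm.aestronglyMeasurable
      simp only [intervalIntegral.integral_of_le zero_le_one]
      exact ((hqm n).stronglyMeasurable.integral_prod_right').aestronglyMeasurable
    · rw [norm_mul]
      have := intervalIntegral.norm_integral_le_of_norm_le_const (a := 0) (b := 1)
        (f := fun θ => q n x θ) fun θ _ => hqb n x θ
      gcongr
      simpa using this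
    · by_cases hx : x ∈ Ω
      · refine Tendsto.mul ?_ tendsto_const_nhds
        have := intervalIntegral.tendsto_integral_filter_of_dominated_convergence
          (μ := volume) (a := 0) (b := 1) (l := atTop) (F := fun n θ => q n x θ)
          (f := fun _ => φ x * F' (u x)) (fun _ => C)
          (Eventually.of_forall fun n =>
            ((hqm n).comp measurable_prodMk_left).aestronglyMeasurable)
          (Eventually.of_forall fun n => Eventually.of_forall fun θ _ => hqb n x θ)
          intervalIntegrable_const (Eventually.of_forall fun θ _ => hqlim x hx θ)
        simpa using this
      · have : g x = 0 := by simp [g, hx]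
        simp [this]
  have hLt : Tendsto (fun n => ∫ x, ((h n)⁻¹ * (φ (x - h n • v) - φ x)) * f x) atTop
      (𝓝 (∫ x, -(fderiv ℝ φ x v) * f x)) := by
    refine tendsto_integral_of_dominated_convergence (fun x => (L * ‖v‖) * ‖f x‖) (fun n => ?_)
      (hfi.norm.const_mul _) (fun n => Eventually.of_forall fun x => ?_)
      (Eventually.of_forall fun x => ?_)
    · refine AEStronglyMeasurable.mul ?_ hfi.aestronglyMeasurable
      exact (continuous_const.mul ((hφc.comp (by fun_prop)).sub hφc)).aestronglyMeasurable
    · rw [norm_mul, norm_mul, norm_inv, Real.norm_eq_abs (h n), abs_of_pos (hpos n)]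
      have h1 := hL.dist_le_mul (x - h n • v) x
      rw [dist_eq_norm, dist_eq_norm, sub_sub_cancel_left, norm_neg, norm_smul,
        Real.norm_eq_abs (h n), abs_of_pos (hpos n)] at h1
      refine mul_le_mul_of_nonneg_right ?_ (norm_nonneg _)
      rw [inv_mul_le_iff₀ (hpos n)]
      linarith
    · refine Tendsto.mul ?_ tendsto_const_nhds
      have hd : HasDerivAt (fun t : ℝ => φ (x + t • (-v))) (fderiv ℝ φ x (-v)) 0 := by
        have h1 : HasFDerivAt φ (fderiv ℝ φ x) (x + (0 : ℝ) • (-v)) := by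
          rw [zero_smul, add_zero]
          exact (hφ.contDiff.differentiable (by simp)).differentiableAt.hasFDerivAt
        refine h1.comp_hasDerivAt (f := fun s : ℝ => x + s • (-v)) (0 : ℝ) ?_
        simpa using ((hasDerivAt_id (0 : ℝ)).smul_const (-v)).const_add x
      have h2 := hd.tendsto_slope_zero.comp (tendsto_nhdsWithin_iff.2
        ⟨hlim, Eventually.of_forall fun n => (hpos n).ne'⟩)
      rw [map_neg] at h2
      refine h2.congr fun n => ?_
      simp [sub_eq_add_neg]
  -- The discrete identity holds once h n is so small that all segments starting in the support of φ
  -- stay in Ω.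
  have heq := tendsto_nhds_unique_of_eventuallyEq hLt hR (by
    filter_upwards [eventually_subset_segmentSet hΩ hφ.hasCompactSupport hφ.tsupport_subset v hlim]
      with n hn
    exact hw.integral_diff_comp hΩ hum hu hGm hG hF hF' hb hFu hφc hC v (hpos n).ne' hn)
  have e1 : ∫ x in Ω, F (u x) * fderiv ℝ φ x v = ∫ x, fderiv ℝ φ x v * f x := by
    rw [← integral_indicator hΩ.measurableSet]
    congr 1
    ext x
    by_cases hx : x ∈ Ω
    · simp [hx, f, mul_comm]
    · simp [hx, f]
  have e2 : ∫ x in Ω, φ x * ⟪F' (u x) • G x, v⟫_ℝ = ∫ x, φ x * F' (u x) * g x := by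
    rw [← integral_indicator hΩ.measurableSet]
    congr 1
    ext x
    by_cases hx : x ∈ Ω
    · simp [hx, g, real_inner_smul_left, mul_assoc]
    · simp [hx, g]
  rw [e1, e2, ← heq, ← integral_neg]
  simp

end ChainRule
-- Exit times and exit points of parallel rays.
section ExitTime

variable {d : ℕ}

/-- The time at which the ray from `x` in direction `e` leaves `Ω` (zero if `x ∉ Ω`). -/
def exitTime (Ω : Set (EuclideanSpace ℝ (Fin d))) (e x : EuclideanSpace ℝ (Fin d)) : ℝ :=
  sSup {t : ℝ | 0 ≤ t ∧ x ∈ segmentSet Ω (t • e)}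

variable {Ω : Set (EuclideanSpace ℝ (Fin d))} {e x : EuclideanSpace ℝ (Fin d)}

lemma mem_segmentSet_smul {t : ℝ} (ht : 0 ≤ t) :
    x ∈ segmentSet Ω (t • e) ↔ ∀ r ∈ Icc 0 t, x + r • e ∈ Ω := by
  constructor
  · intro h r hr
    rcases ht.eq_or_lt with rfl | ht'
    · have hr0 : r = 0 := le_antisymm hr.2 hr.1
      subst hr0
      simpa using h 0 (by simp)
    · have := h (r / t) ⟨div_nonneg hr.1 ht, (div_le_one ht').2 hr.2⟩
      rwa [smul_smul, div_mul_cancel₀ _ ht'.ne'] at this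
  · intro h θ hθ
    rw [smul_smul]
    exact h _ ⟨mul_nonneg hθ.1 ht, mul_le_of_le_one_left ht hθ.2⟩

lemma exitTime_nonneg : 0 ≤ exitTime Ω e x := Real.sSup_nonneg fun _ h => h.1

lemma bound_of_mem_segmentSet {R : ℝ} (hR : ∀ x ∈ Ω, ‖x‖ ≤ R) (he : ‖e‖ = 1) {t : ℝ} (ht : 0 ≤ t)
    (h : x ∈ segmentSet Ω (t • e)) : t ≤ 2 * R := by
  have h0 := hR _ ((mem_segmentSet_smul ht).1 h 0 ⟨le_rfl, ht⟩)
  have h1 := hR _ ((mem_segmentSet_smul ht).1 h t ⟨ht, le_rfl⟩)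
  have h2 : ‖t • e‖ = t := by rw [norm_smul, he, mul_one, Real.norm_eq_abs, abs_of_nonneg ht]
  have h3 : t • e = (x + t • e) - (x + (0 : ℝ) • e) := by module
  have := norm_sub_le (x + t • e) (x + (0 : ℝ) • e)
  rw [← h3, h2] at this
  linarith

lemma exitTime_le {R : ℝ} (hR0 : 0 ≤ R) (hR : ∀ x ∈ Ω, ‖x‖ ≤ R) (he : ‖e‖ = 1) :
    exitTime Ω e x ≤ 2 * R :=
  Real.sSup_le (fun _ h => bound_of_mem_segmentSet hR he h.1 h.2) (by positivity)

lemma mem_segmentSet_of_lt_exitTime {t : ℝ} (ht : 0 ≤ t) (h : t < exitTime Ω e x) :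
    x ∈ segmentSet Ω (t • e) := by
  have hne : {t : ℝ | 0 ≤ t ∧ x ∈ segmentSet Ω (t • e)}.Nonempty := by
    by_contra hc
    rw [not_nonempty_iff_eq_empty] at hc
    rw [exitTime, hc, Real.sSup_empty] at h
    linarith
  obtain ⟨s, hs, hts⟩ := exists_lt_of_lt_csSup hne h
  rw [mem_segmentSet_smul ht]
  exact fun r hr => (mem_segmentSet_smul hs.1).1 hs.2 r ⟨hr.1, hr.2.trans hts.le⟩

lemma lt_exitTime {R : ℝ} (hΩ : IsOpen Ω) (hR : ∀ x ∈ Ω, ‖x‖ ≤ R) (he : ‖e‖ = 1) {t : ℝ}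
    (ht : 0 ≤ t) (h : x ∈ segmentSet Ω (t • e)) : t < exitTime Ω e x := by
  have hbdd : BddAbove {t : ℝ | 0 ≤ t ∧ x ∈ segmentSet Ω (t • e)} :=
    ⟨2 * R, fun s hs => bound_of_mem_segmentSet hR he hs.1 hs.2⟩
  have hend := (mem_segmentSet_smul ht).1 h t ⟨ht, le_rfl⟩
  have hc : Continuous fun r : ℝ => x + r • e := by fun_prop
  obtain ⟨δ, hδ, hball⟩ := Metric.isOpen_iff.1 (hΩ.preimage hc) t hend
  refine lt_of_lt_of_le (show t < t + δ / 2 by linarith) (le_csSup hbdd ⟨by linarith, ?_⟩)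
  rw [mem_segmentSet_smul (by linarith)]
  intro r hr
  rcases le_or_gt r t with hrt | hrt
  · exact (mem_segmentSet_smul ht).1 h r ⟨hr.1, hrt⟩
  · refine hball (Metric.mem_ball.2 ?_)
    rw [Real.dist_eq, abs_of_pos (sub_pos.2 hrt)]
    linarith [hr.2]

/-- For s ≥ 0 the set where the exit time exceeds s is the open set `segmentSet Ω (s • e)`; the
inequality is strict because openness prolongs every segment in Ω. -/
lemma measurable_exitTime {R : ℝ} (hΩ : IsOpen Ω) (hR : ∀ x ∈ Ω, ‖x‖ ≤ R) (he : ‖e‖ = 1) :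
    Measurable (exitTime Ω e) := by
  refine measurable_of_Ioi fun s => ?_
  rcases lt_or_ge s 0 with hs | hs
  · convert MeasurableSet.univ
    exact eq_univ_of_forall fun x => hs.trans_le exitTime_nonneg
  · convert (isOpen_segmentSet hΩ (s • e)).measurableSet
    ext x
    exact ⟨fun h => mem_segmentSet_of_lt_exitTime hs h, fun h => lt_exitTime hΩ hR he hs h⟩

/-- The point at which the ray from `x` in direction `e` leaves `Ω`. -/
def exitPoint (Ω : Set (EuclideanSpace ℝ (Fin d))) (e x : EuclideanSpace ℝ (Fin d)) :
    EuclideanSpace ℝ (Fin d) := x + exitTime Ω e x • e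

lemma measurable_exitPoint {R : ℝ} (hΩ : IsOpen Ω) (hR : ∀ x ∈ Ω, ‖x‖ ≤ R) (he : ‖e‖ = 1) :
    Measurable (exitPoint Ω e) :=
  measurable_id.add ((measurable_exitTime hΩ hR he).smul_const e)

lemma exitTime_pos {R : ℝ} (hΩ : IsOpen Ω) (hR : ∀ x ∈ Ω, ‖x‖ ≤ R) (he : ‖e‖ = 1) (hx : x ∈ Ω) :
    0 < exitTime Ω e x :=
  lt_exitTime hΩ hR he le_rfl (by rw [mem_segmentSet_smul le_rfl]; intro r hr; simp_all)

lemma add_smul_mem_of_lt_exitTime {t : ℝ} (ht : 0 ≤ t) (h : t < exitTime Ω e x) : x + t • e ∈ Ω :=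
  (mem_segmentSet_smul ht).1 (mem_segmentSet_of_lt_exitTime ht h) t ⟨ht, le_rfl⟩

/-- Rational times matter because the integral formula along a segment holds off a null set that
depends on its length; countably many lengths share one null set. -/
lemma exists_rat_tendsto_exitTime {R : ℝ} (hΩ : IsOpen Ω) (hR : ∀ x ∈ Ω, ‖x‖ ≤ R) (he : ‖e‖ = 1)
    (hx : x ∈ Ω) : ∃ q : ℕ → ℚ, (∀ n, 0 ≤ (q n : ℝ) ∧ (q n : ℝ) < exitTime Ω e x) ∧
      Tendsto (fun n => (q n : ℝ)) atTop (𝓝 (exitTime Ω e x)) := by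
  have hpos := exitTime_pos hΩ hR he hx
  have hex : ∀ n : ℕ, ∃ q : ℚ, max 0 (exitTime Ω e x - 1 / ((n : ℝ) + 1)) < q ∧
      (q : ℝ) < exitTime Ω e x := fun n => exists_rat_btwn (max_lt hpos (by
        have : (0 : ℝ) < 1 / ((n : ℝ) + 1) := by positivity
        linarith))
  choose q hq1 hq2 using hex
  refine ⟨q, fun n => ⟨((le_max_left _ _).trans_lt (hq1 n)).le, hq2 n⟩, ?_⟩
  refine tendsto_of_tendsto_of_tendsto_of_le_of_le (g := fun n : ℕ =>
    exitTime Ω e x - 1 / ((n : ℝ) + 1)) ?_ tendsto_const_nhds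
    (fun n => ((le_max_right _ _).trans_lt (hq1 n)).le) (fun n => (hq2 n).le)
  simpa using tendsto_const_nhds.sub (tendsto_one_div_add_atTop_nhds_zero_nat (𝕜 := ℝ))

lemma exitPoint_mem_frontier {R : ℝ} (hΩ : IsOpen Ω) (hR : ∀ x ∈ Ω, ‖x‖ ≤ R) (he : ‖e‖ = 1)
    (hx : x ∈ Ω) : exitPoint Ω e x ∈ frontier Ω := by
  rw [hΩ.frontier_eq]
  refine ⟨?_, fun hmem => ?_⟩
  · obtain ⟨q, hq, hlim⟩ := exists_rat_tendsto_exitTime hΩ hR he hx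
    exact mem_closure_of_tendsto ((hlim.smul_const e).const_add x)
      (Eventually.of_forall fun n => add_smul_mem_of_lt_exitTime (hq n).1 (hq n).2)
  · refine lt_irrefl _ (lt_exitTime hΩ hR he exitTime_nonneg (x := x) ?_)
    rw [mem_segmentSet_smul exitTime_nonneg]
    intro r hr
    rcases hr.2.eq_or_lt with h | h
    · rw [h]; exact hmem
    · exact add_smul_mem_of_lt_exitTime hr.1 h

end ExitTime

/-! ### The image of Lebesgue measure under the exit map. -/

section Cylinder

variable {n : ℕ}

/-- The projection of `ℝ^(n+1)` onto the last `n` coordinates. -/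
def tailProj (x : EuclideanSpace ℝ (Fin (n + 1))) : Fin n → ℝ := fun i => x i.succ

lemma lipschitzWith_tailProj : LipschitzWith 1 (tailProj (n := n)) := by
  refine LipschitzWith.of_dist_le_mul fun x y => ?_
  rw [NNReal.coe_one, one_mul]
  refine (dist_pi_le_iff dist_nonneg).2 fun i => ?_
  have := PiLp.norm_apply_le (x - y) i.succ
  rwa [← dist_eq_norm] at this

lemma volume_cylinder (I : Set ℝ) (T : Set (Fin n → ℝ)) :
    volume {x : EuclideanSpace ℝ (Fin (n + 1)) | x 0 ∈ I ∧ tailProj x ∈ T} = volume I * volume T := by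
  let f := (MeasurableEquiv.toLp 2 (Fin (n + 1) → ℝ)).symm
  let g := MeasurableEquiv.piFinSuccAbove (fun _ : Fin (n + 1) => ℝ) 0
  have hf : MeasurePreserving f volume volume :=
    EuclideanSpace.volume_preserving_symm_measurableEquiv_toLp _
  have hg : MeasurePreserving g volume volume := volume_preserving_piFinSuccAbove (fun _ => ℝ) 0
  have h := (hg.comp hf).measure_preimage_equiv (f := f.trans g) (I ×ˢ T)
  rw [Measure.volume_eq_prod, Measure.prod_prod] at h
  rw [← h]
  congr 1

/-- Moving in direction 0 keeps the other coordinates, so the set lies in a cylinder of height 2R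
over the shadow of A ∩ Γ. The projection being 1-Lipschitz, the shadow has measure at most σ(A ∩ Γ).
-/
lemma volume_exitPoint_preimage_le {Ω : Set (EuclideanSpace ℝ (Fin (n + 1)))} {R : ℝ}
    (hΩ : IsOpen Ω) (hR : ∀ x ∈ Ω, ‖x‖ ≤ R) {A : Set (EuclideanSpace ℝ (Fin (n + 1)))}
    (hA : MeasurableSet A) :
    volume (exitPoint Ω (EuclideanSpace.single 0 1) ⁻¹' A ∩ Ω)
      ≤ ENNReal.ofReal (2 * R) * boundaryMeasure Ω A := by
  let T : Set (Fin n → ℝ) := tailProj '' (A ∩ frontier Ω)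
  have hsub : exitPoint Ω (EuclideanSpace.single 0 1) ⁻¹' A ∩ Ω
      ⊆ {x : EuclideanSpace ℝ (Fin (n + 1)) | x 0 ∈ Icc (-R) R ∧ tailProj x ∈ T} := by
    rintro x ⟨hxA, hx⟩
    refine ⟨?_, exitPoint Ω (EuclideanSpace.single 0 1) x,
      ⟨hxA, exitPoint_mem_frontier hΩ hR (by simp) hx⟩, ?_⟩
    · exact abs_le.1 ((PiLp.norm_apply_le x 0).trans (hR x hx))
    · ext i
      simp [tailProj, exitPoint]
  have hT : volume T ≤ boundaryMeasure Ω A := by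
    -- In `Fin n → ℝ` with its sup norm the n-dimensional Hausdorff measure is Lebesgue measure,
    -- with no normalising constant.
    rw [boundaryMeasure, Measure.restrict_apply hA, ← hausdorffMeasure_pi_real]
    have := lipschitzWith_tailProj.hausdorffMeasure_image_le (d := n) (Nat.cast_nonneg n)
      (A ∩ frontier Ω)
    simpa using this
  refine (measure_mono hsub).trans ?_
  rw [volume_cylinder, Real.volume_Icc]
  have : R - -R = 2 * R := by ring
  rw [this]
  gcongr

lemma map_exitPoint_le {Ω : Set (EuclideanSpace ℝ (Fin (n + 1)))} {R : ℝ}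
    (hΩ : IsOpen Ω) (hR : ∀ x ∈ Ω, ‖x‖ ≤ R) :
    (volume.restrict Ω).map (exitPoint Ω (EuclideanSpace.single 0 1))
      ≤ ENNReal.ofReal (2 * R) • boundaryMeasure Ω := by
  have hm := measurable_exitPoint (e := EuclideanSpace.single 0 1) hΩ hR (by simp)
  refine Measure.le_iff.2 fun A hA => ?_
  rw [Measure.map_apply hm hA, Measure.restrict_apply (hm hA), Measure.smul_apply, smul_eq_mul]
  exact volume_exitPoint_preimage_le hΩ hR hA

end Cylinder

/-! ### Maz'ya's inequality. -/

section Poincare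

open scoped InnerProductSpace

lemma sq_lintegral_le {α : Type*} [MeasurableSpace α] {μ : Measure α} {f : α → ℝ≥0∞}
    (hf : AEMeasurable f μ) : (∫⁻ x, f x ∂μ) ^ 2 ≤ μ univ * ∫⁻ x, f x ^ 2 ∂μ := by
  have h := ENNReal.lintegral_mul_le_Lp_mul_Lq μ (Real.HolderConjugate.two_two) hf
    (aemeasurable_const (b := (1 : ℝ≥0∞)))
  simp only [Pi.mul_apply, mul_one, ENNReal.one_rpow, lintegral_const, one_mul] at h
  calc (∫⁻ x, f x ∂μ) ^ 2
      ≤ ((∫⁻ x, f x ^ (2 : ℝ) ∂μ) ^ (1 / (2 : ℝ)) * μ univ ^ (1 / (2 : ℝ))) ^ 2 := by gcongr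
    _ = μ univ * ∫⁻ x, f x ^ 2 ∂μ := by
      rw [mul_pow, ← ENNReal.rpow_natCast, ← ENNReal.rpow_mul, ← ENNReal.rpow_natCast,
        ← ENNReal.rpow_mul, mul_comm]
      norm_num

lemma add_sq_le_ennreal (a b : ℝ≥0∞) : (a + b) ^ 2 ≤ 2 * (a ^ 2 + b ^ 2) := by
  have := ENNReal.rpow_add_le_mul_rpow_add_rpow a b (p := 2) (by norm_num)
  norm_num at this
  exact this

variable {d : ℕ}

/-- Along almost every ray a continuous Sobolev function is controlled by its value at the exit
point and its weak gradient on the ray. -/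
lemma HasWeakGradient.ae_enorm_sub_exitPoint_le {Ω : Set (EuclideanSpace ℝ (Fin d))} {R : ℝ}
    {e : EuclideanSpace ℝ (Fin d)} (hΩ : IsOpen Ω) (hR0 : 0 ≤ R) (hR : ∀ x ∈ Ω, ‖x‖ ≤ R)
    (he : ‖e‖ = 1) {u : EuclideanSpace ℝ (Fin d) → ℝ}
    {G : EuclideanSpace ℝ (Fin d) → EuclideanSpace ℝ (Fin d)}
    (huc : ContinuousOn u (closure Ω)) (hu : IntegrableOn u Ω) (hGm : StronglyMeasurable G)
    (hG : IntegrableOn G Ω) (h : HasWeakGradient Ω u G) :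
    ∀ᵐ x, x ∈ Ω → ‖u (exitPoint Ω e x) - u x‖ₑ ^ 2
      ≤ ENNReal.ofReal (2 * R) * ∫⁻ r in Ioc (0 : ℝ) (2 * R), ‖Ω.indicator G (x + r • e)‖ₑ ^ 2 := by
  have hae : ∀ᵐ x, ∀ q : ℚ, x ∈ segmentSet Ω ((q : ℝ) • e) →
      u (x + (q : ℝ) • e) - u x
        = ∫ θ in (0 : ℝ)..1, ⟪Ω.indicator G (x + θ • (q : ℝ) • e), (q : ℝ) • e⟫_ℝ :=
    ae_all_iff.2 fun q => h.ae_sub_eq_integral hΩ hu hGm hG _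
  have hGm' : StronglyMeasurable (Ω.indicator G) := hGm.indicator hΩ.measurableSet
  filter_upwards [hae] with x hx hxΩ
  have hm : Measurable fun r : ℝ => ‖Ω.indicator G (x + r • e)‖ₑ :=
    (hGm'.measurable.comp (by fun_prop)).enorm
  have hq : ∀ q : ℚ, 0 ≤ (q : ℝ) → (q : ℝ) < exitTime Ω e x →
      ‖u (x + (q : ℝ) • e) - u x‖ₑ ^ 2 ≤ ENNReal.ofReal (2 * R) *
        ∫⁻ r in Ioc (0 : ℝ) (2 * R), ‖Ω.indicator G (x + r • e)‖ₑ ^ 2 := by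
    intro q hq0 hq
    have hqR : (q : ℝ) ≤ 2 * R := hq.le.trans (exitTime_le hR0 hR he)
    have e1 : u (x + (q : ℝ) • e) - u x
        = ∫ r in (0 : ℝ)..q, ⟪Ω.indicator G (x + r • e), e⟫_ℝ := by
      rw [hx q (mem_segmentSet_of_lt_exitTime hq0 hq)]
      have := intervalIntegral.mul_integral_comp_mul_right (a := 0) (b := 1)
        (f := fun r : ℝ => ⟪Ω.indicator G (x + r • e), e⟫_ℝ) (q : ℝ)
      rw [zero_mul, one_mul] at this
      rw [← this]
      simp only [real_inner_smul_right, intervalIntegral.integral_const_mul, smul_smul]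
    have e2 : ‖u (x + (q : ℝ) • e) - u x‖ₑ
        ≤ ∫⁻ r in Ioc (0 : ℝ) (2 * R), ‖Ω.indicator G (x + r • e)‖ₑ := by
      rw [e1, intervalIntegral.integral_of_le hq0]
      refine (enorm_integral_le_lintegral_enorm _).trans ?_
      refine (lintegral_mono fun r => ?_).trans
        (lintegral_mono_set (Ioc_subset_Ioc_right hqR))
      rw [enorm_le_iff_norm_le]
      simpa [he] using norm_inner_le_norm (𝕜 := ℝ) (Ω.indicator G (x + r • e)) e
    calc _ ≤ (∫⁻ r in Ioc (0 : ℝ) (2 * R), ‖Ω.indicator G (x + r • e)‖ₑ) ^ 2 := by gcongr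
      _ ≤ _ := by
        have := sq_lintegral_le (μ := volume.restrict (Ioc (0 : ℝ) (2 * R))) hm.aemeasurable
        simpa using this
  obtain ⟨q, hq1, hqlim⟩ := exists_rat_tendsto_exitTime hΩ hR he hxΩ
  have hmem : exitPoint Ω e x ∈ closure Ω :=
    frontier_subset_closure (exitPoint_mem_frontier hΩ hR he hxΩ)
  have hlim : Tendsto (fun k => u (x + (q k : ℝ) • e)) atTop (𝓝 (u (exitPoint Ω e x))) := by
    refine (huc _ hmem).tendsto.comp (tendsto_nhdsWithin_iff.2
      ⟨(hqlim.smul_const e).const_add x, Eventually.of_forall fun k =>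
        subset_closure (add_smul_mem_of_lt_exitTime (hq1 k).1 (hq1 k).2)⟩)
  have hlim2 : Tendsto (fun k => ‖u (x + (q k : ℝ) • e) - u x‖ₑ ^ 2) atTop
      (𝓝 (‖u (exitPoint Ω e x) - u x‖ₑ ^ 2)) :=
    ((ENNReal.continuous_pow 2).tendsto _).comp ((hlim.sub_const (u x)).enorm)
  exact le_of_tendsto hlim2 (Eventually.of_forall fun k => hq _ (hq1 k).1 (hq1 k).2)

/-- A Poincaré inequality with boundary term (Maz'ya). -/
theorem HasWeakGradient.lintegral_sq_le {n : ℕ} {Ω : Set (EuclideanSpace ℝ (Fin (n + 1)))} {R : ℝ}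
    (hΩ : IsOpen Ω) (hR0 : 0 ≤ R) (hR : ∀ x ∈ Ω, ‖x‖ ≤ R)
    {u : EuclideanSpace ℝ (Fin (n + 1)) → ℝ}
    {G : EuclideanSpace ℝ (Fin (n + 1)) → EuclideanSpace ℝ (Fin (n + 1))}
    (huc : ContinuousOn u (closure Ω)) (hu : IntegrableOn u Ω) (hGm : StronglyMeasurable G)
    (hG : IntegrableOn G Ω) (h : HasWeakGradient Ω u G) :
    ∫⁻ x in Ω, ‖u x‖ₑ ^ 2 ≤ 2 * (ENNReal.ofReal (2 * R) * ∫⁻ x, ‖u x‖ₑ ^ 2 ∂(boundaryMeasure Ω)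
      + ENNReal.ofReal (2 * R) ^ 2 * ∫⁻ x in Ω, ‖G x‖ₑ ^ 2) := by
  let e : EuclideanSpace ℝ (Fin (n + 1)) := EuclideanSpace.single 0 1
  have he : ‖e‖ = 1 := by simp [e]
  have hGm' : StronglyMeasurable (Ω.indicator G) := hGm.indicator hΩ.measurableSet
  -- Nothing is known of u off the closure of Ω; cutting it off there gives a measurable function,
  -- as the change of variables requires.
  let w : EuclideanSpace ℝ (Fin (n + 1)) → ℝ := (closure Ω).indicator u
  have hwm : Measurable w := by
    classical
    rw [show w = (closure Ω).piecewise u 0 from (piecewise_eq_indicator ..).symm]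
    exact huc.measurable_piecewise continuousOn_const isClosed_closure.measurableSet
  have hpm : Measurable (exitPoint Ω e) := measurable_exitPoint hΩ hR he
  have h1 : ∀ᵐ x ∂(volume.restrict Ω), ‖u x‖ₑ ^ 2 ≤ 2 * (‖w (exitPoint Ω e x)‖ₑ ^ 2
      + ENNReal.ofReal (2 * R) *
        ∫⁻ r in Ioc (0 : ℝ) (2 * R), ‖Ω.indicator G (x + r • e)‖ₑ ^ 2) := by
    rw [ae_restrict_iff' hΩ.measurableSet]
    filter_upwards [h.ae_enorm_sub_exitPoint_le hΩ hR0 hR he huc hu hGm hG] with x hx hxΩ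
    have hmem : exitPoint Ω e x ∈ closure Ω :=
      frontier_subset_closure (exitPoint_mem_frontier hΩ hR he hxΩ)
    have e1 : ‖u x‖ₑ ≤ ‖w (exitPoint Ω e x)‖ₑ + ‖u (exitPoint Ω e x) - u x‖ₑ := by
      have : u x = w (exitPoint Ω e x) - (u (exitPoint Ω e x) - u x) := by
        simp [w, hmem]
      nth_rewrite 1 [this]
      exact enorm_sub_le
    calc ‖u x‖ₑ ^ 2 ≤ (‖w (exitPoint Ω e x)‖ₑ + ‖u (exitPoint Ω e x) - u x‖ₑ) ^ 2 := by gcongr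
      _ ≤ _ := add_sq_le_ennreal _ _
      _ ≤ _ := by gcongr; exact hx hxΩ
  have hwm2 : Measurable fun x => ‖w x‖ₑ ^ 2 := hwm.enorm.pow_const 2
  have hFm : Measurable fun p : EuclideanSpace ℝ (Fin (n + 1)) × ℝ =>
      ‖Ω.indicator G (p.1 + p.2 • e)‖ₑ ^ 2 :=
    (hGm'.measurable.comp (by fun_prop)).enorm.pow_const 2
  have h2 : ∫⁻ x in Ω, ‖w (exitPoint Ω e x)‖ₑ ^ 2
      ≤ ENNReal.ofReal (2 * R) * ∫⁻ x, ‖u x‖ₑ ^ 2 ∂(boundaryMeasure Ω) := by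
    rw [← lintegral_map hwm2 hpm]
    refine (lintegral_mono' (map_exitPoint_le hΩ hR) le_rfl).trans ?_
    rw [lintegral_smul_measure, smul_eq_mul]
    gcongr with x
    by_cases hx : x ∈ closure Ω <;> simp [w, hx]
  -- After exchanging the integrals, translation invariance makes the inner one independent of r,
  -- leaving a factor 2R.
  have h3 : ∫⁻ x in Ω, ∫⁻ r in Ioc (0 : ℝ) (2 * R), ‖Ω.indicator G (x + r • e)‖ₑ ^ 2
      ≤ ENNReal.ofReal (2 * R) * ∫⁻ x in Ω, ‖G x‖ₑ ^ 2 := by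
    refine (setLIntegral_le_lintegral _ _).trans ?_
    rw [lintegral_lintegral_swap hFm.aemeasurable]
    have e1 : ∀ r : ℝ, ∫⁻ x, ‖Ω.indicator G (x + r • e)‖ₑ ^ 2 = ∫⁻ x in Ω, ‖G x‖ₑ ^ 2 := by
      intro r
      rw [lintegral_add_right_eq_self (fun x => ‖Ω.indicator G x‖ₑ ^ 2) (r • e),
        ← lintegral_indicator hΩ.measurableSet]
      congr 1
      ext x
      by_cases hx : x ∈ Ω <;> simp [hx]
    simp [e1, mul_comm]
  have hm1 : Measurable fun x => ‖w (exitPoint Ω e x)‖ₑ ^ 2 := hwm2.comp hpm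
  have hm2 : Measurable fun x => ∫⁻ r in Ioc (0 : ℝ) (2 * R), ‖Ω.indicator G (x + r • e)‖ₑ ^ 2 :=
    hFm.lintegral_prod_right'
  have hm3 : Measurable fun x => ‖w (exitPoint Ω e x)‖ₑ ^ 2 + ENNReal.ofReal (2 * R) *
      ∫⁻ r in Ioc (0 : ℝ) (2 * R), ‖Ω.indicator G (x + r • e)‖ₑ ^ 2 := hm1.add (hm2.const_mul _)
  calc ∫⁻ x in Ω, ‖u x‖ₑ ^ 2 ≤ _ := lintegral_mono_ae h1
    _ = 2 * ((∫⁻ x in Ω, ‖w (exitPoint Ω e x)‖ₑ ^ 2) + ENNReal.ofReal (2 * R) * ∫⁻ x in Ω,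
        ∫⁻ r in Ioc (0 : ℝ) (2 * R), ‖Ω.indicator G (x + r • e)‖ₑ ^ 2) := by
      rw [lintegral_const_mul _ hm3, lintegral_add_left hm1,
        lintegral_const_mul _ hm2]
    _ ≤ _ := by
      rw [sq (ENNReal.ofReal (2 * R)), mul_assoc]
      gcongr

lemma ofReal_norm_sq {α F : Type*} [MeasurableSpace α] [NormedAddCommGroup F] {μ : Measure α}
    (f : Lp F 2 μ) : ENNReal.ofReal (‖f‖ ^ 2) = ∫⁻ x, ‖f x‖ₑ ^ 2 ∂μ := by
  have h := eLpNorm_nnreal_pow_eq_lintegral (f := f) (μ := μ) (p := 2) two_ne_zero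
  rw [ENNReal.ofReal_pow (norm_nonneg _), ofReal_norm, Lp.enorm_def]
  norm_num at h
  exact h

lemma integrableOn_of_Lp {d : ℕ} {F : Type*} [NormedAddCommGroup F]
    {Ω : Set (EuclideanSpace ℝ (Fin d))} (hb : Bornology.IsBounded Ω)
    (f : Lp F 2 (volume.restrict Ω)) : IntegrableOn f Ω := by
  have : IsFiniteMeasure (volume.restrict Ω) := ⟨by
    rw [Measure.restrict_apply_univ]; exact hb.measure_lt_top⟩
  exact (Lp.memLp f).integrable (by norm_num)

lemma HasWeakGradient.congr {d : ℕ} {Ω : Set (EuclideanSpace ℝ (Fin d))}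
    {u u' : EuclideanSpace ℝ (Fin d) → ℝ}
    {G G' : EuclideanSpace ℝ (Fin d) → EuclideanSpace ℝ (Fin d)} (h : HasWeakGradient Ω u G)
    (hu : u =ᵐ[volume.restrict Ω] u') (hG : G =ᵐ[volume.restrict Ω] G') :
    HasWeakGradient Ω u' G' := by
  intro φ hφ v
  have e1 : ∫ x in Ω, u' x * fderiv ℝ φ x v = ∫ x in Ω, u x * fderiv ℝ φ x v :=
    integral_congr_ae (hu.mono fun x hx => by simp only [hx])
  have e2 : ∫ x in Ω, φ x * ⟪G' x, v⟫_ℝ = ∫ x in Ω, φ x * ⟪G x, v⟫_ℝ :=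
    integral_congr_ae (hG.mono fun x hx => by simp only [hx])
  rw [e1, e2]
  exact h φ hφ v

lemma hasWeakGradient_grad {d : ℕ} {Ω : Set (EuclideanSpace ℝ (Fin d))} (u : H1 Ω) :
    HasWeakGradient Ω (toL2 u) (grad u) := u.2

/-- A Poincaré inequality with boundary term (Maz'ya), for `H¹(Ω) ∩ C(closure Ω)`. -/
theorem exists_norm_toL2_sq_le {d : ℕ} (hd : 1 ≤ d) {Ω : Set (EuclideanSpace ℝ (Fin d))}
    (hΩ : IsOpen Ω) (hb : Bornology.IsBounded Ω) :
    ∃ C : ℝ, 0 ≤ C ∧ ∀ (u : H1 Ω) (g : Lp ℝ 2 (boundaryMeasure Ω)),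
      IsContinuousWithRestriction Ω u g → ‖toL2 u‖ ^ 2 ≤ C * (‖grad u‖ ^ 2 + ‖g‖ ^ 2) := by
  obtain ⟨n, rfl⟩ : ∃ n, d = n + 1 := ⟨d - 1, by omega⟩
  obtain ⟨R, hR0, hR⟩ := hb.exists_pos_norm_le
  refine ⟨2 * (2 * R) + 2 * (2 * R) ^ 2, by positivity, ?_⟩
  rintro u g ⟨w, hwc, huw, hgw⟩
  have hwi : IntegrableOn w Ω := (integrableOn_of_Lp hb (toL2 u)).congr huw
  have hwg : HasWeakGradient Ω w (grad u) := (hasWeakGradient_grad u).congr huw .rfl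
  have key := hwg.lintegral_sq_le hΩ hR0.le hR hwc hwi (Lp.stronglyMeasurable _)
    (integrableOn_of_Lp hb (grad u))
  have e1 : ∫⁻ x in Ω, ‖w x‖ₑ ^ 2 = ENNReal.ofReal (‖toL2 u‖ ^ 2) := by
    rw [ofReal_norm_sq]
    exact lintegral_congr_ae (huw.mono fun x hx => by simp only [hx])
  have e2 : ∫⁻ x, ‖w x‖ₑ ^ 2 ∂(boundaryMeasure Ω) = ENNReal.ofReal (‖g‖ ^ 2) := by
    rw [ofReal_norm_sq]
    exact lintegral_congr_ae (hgw.mono fun x hx => by simp only [hx])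
  have e3 : 2 * (ENNReal.ofReal (2 * R) * ENNReal.ofReal (‖g‖ ^ 2)
      + ENNReal.ofReal (2 * R) ^ 2 * ENNReal.ofReal (‖grad u‖ ^ 2))
      = ENNReal.ofReal (2 * (2 * R * ‖g‖ ^ 2 + (2 * R) ^ 2 * ‖grad u‖ ^ 2)) := by
    symm
    rw [ENNReal.ofReal_mul zero_le_two, ENNReal.ofReal_ofNat,
      ENNReal.ofReal_add (by positivity) (by positivity),
      ENNReal.ofReal_mul (p := 2 * R) (q := ‖g‖ ^ 2) (by positivity),
      ENNReal.ofReal_mul (p := (2 * R) ^ 2) (by positivity),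
      ENNReal.ofReal_pow (p := 2 * R) (by positivity)]
  rw [e1, e2, ← ofReal_norm_sq, e3, ENNReal.ofReal_le_ofReal_iff (by positivity)] at key
  have p1 : 0 ≤ R * ‖grad u‖ ^ 2 := by positivity
  have p2 : 0 ≤ R ^ 2 * ‖g‖ ^ 2 := by positivity
  nlinarith

end Poincare
-- Completeness of H¹ and contractions acting on it.
section Sobolev

open scoped InnerProductSpace

variable {d : ℕ} {Ω : Set (EuclideanSpace ℝ (Fin d))}

lemma exists_H1 {u : EuclideanSpace ℝ (Fin d) → ℝ}
    {G : EuclideanSpace ℝ (Fin d) → EuclideanSpace ℝ (Fin d)}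
    (hu : MemLp u 2 (volume.restrict Ω)) (hG : MemLp G 2 (volume.restrict Ω))
    (h : HasWeakGradient Ω u G) :
    ∃ p : H1 Ω, toL2 p =ᵐ[volume.restrict Ω] u ∧ grad p =ᵐ[volume.restrict Ω] G :=
  ⟨⟨WithLp.toLp 2 (hu.toLp u, hG.toLp G), h.congr hu.coeFn_toLp.symm hG.coeFn_toLp.symm⟩,
    hu.coeFn_toLp, hG.coeFn_toLp⟩

lemma integral_mul_eq_inner {α : Type*} [MeasurableSpace α] {μ : Measure α} (f g : Lp ℝ 2 μ) :
    ∫ x, f x * g x ∂μ = ⟪f, g⟫_ℝ := by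
  rw [L2.inner_def]
  simp only [RCLike.inner_apply, conj_trivial, mul_comm]

/-- For fixed φ and v both sides of the defining identity are L₂ inner products with fixed elements,
hence continuous. -/
lemma isClosed_H1 : IsClosed (H1 Ω : Set (WithLp 2 (Lp ℝ 2 (volume.restrict Ω) ×
    Lp (EuclideanSpace ℝ (Fin d)) 2 (volume.restrict Ω)))) := by
  have : (H1 Ω : Set (WithLp 2 (Lp ℝ 2 (volume.restrict Ω) ×
      Lp (EuclideanSpace ℝ (Fin d)) 2 (volume.restrict Ω))))
      = {p | ∀ φ : EuclideanSpace ℝ (Fin d) → ℝ, IsTestFunction Ω φ →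
        ∀ v : EuclideanSpace ℝ (Fin d),
          ∫ x in Ω, p.fst x * fderiv ℝ φ x v = - ∫ x in Ω, φ x * ⟪p.snd x, v⟫_ℝ} := rfl
  rw [this]
  simp only [ofPred_forall]
  refine isClosed_iInter fun φ => isClosed_iInter fun hφ => isClosed_iInter fun v => ?_
  have m1 := hφ.memLp_fderiv v
  have m2 : MemLp (fun x => φ x • v) 2 (volume.restrict Ω) :=
    ((hφ.contDiff.continuous.smul continuous_const).memLp_of_hasCompactSupport
      hφ.hasCompactSupport.smul_right).restrict Ω
  have e1 (p : Lp ℝ 2 (volume.restrict Ω)) :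
      ∫ x in Ω, p x * fderiv ℝ φ x v = ⟪p, m1.toLp _⟫_ℝ := by
    rw [← integral_mul_eq_inner]
    exact integral_congr_ae (m1.coeFn_toLp.mono fun x hx => by simp only [hx])
  have e2 (p : Lp (EuclideanSpace ℝ (Fin d)) 2 (volume.restrict Ω)) :
      ∫ x in Ω, φ x * ⟪p x, v⟫_ℝ = ⟪p, m2.toLp _⟫_ℝ := by
    rw [L2.inner_def]
    exact integral_congr_ae (m2.coeFn_toLp.mono fun x hx => by
      simp only [hx, real_inner_smul_right])
  simp only [e1, e2]
  have c1 := (WithLp.fstL 2 ℝ (Lp ℝ 2 (volume.restrict Ω))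
    (Lp (EuclideanSpace ℝ (Fin d)) 2 (volume.restrict Ω))).continuous
  have c2 := (WithLp.sndL 2 ℝ (Lp ℝ 2 (volume.restrict Ω))
    (Lp (EuclideanSpace ℝ (Fin d)) 2 (volume.restrict Ω))).continuous
  exact isClosed_eq (c1.inner continuous_const) (c2.inner continuous_const).neg

instance : CompleteSpace (H1 Ω) := isClosed_H1.completeSpace_coe

lemma memLp_of_continuousOn_closure (hb : Bornology.IsBounded Ω) {μ : Measure (EuclideanSpace ℝ (Fin d))}
    [IsFiniteMeasure μ] {F : Type*} [NormedAddCommGroup F] {w : EuclideanSpace ℝ (Fin d) → F}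
    (hw : ContinuousOn w (closure Ω)) (hwm : AEStronglyMeasurable w μ)
    (hμ : ∀ᵐ x ∂μ, x ∈ closure Ω) : MemLp w 2 μ := by
  obtain ⟨C, hC⟩ := hb.isCompact_closure.exists_bound_of_continuousOn hw
  exact MemLp.of_bound hwm C (hμ.mono fun x hx => hC x hx)

lemma isFiniteMeasure_restrict (hb : Bornology.IsBounded Ω) :
    IsFiniteMeasure (volume.restrict Ω) :=
  ⟨by rw [Measure.restrict_apply_univ]; exact hb.measure_lt_top⟩

lemma ae_mem_closure (hΩ : IsOpen Ω) : ∀ᵐ x ∂(volume.restrict Ω), x ∈ closure Ω :=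
  (ae_restrict_mem hΩ.measurableSet).mono fun _ hx => subset_closure hx

lemma ae_boundary_mem_closure : ∀ᵐ x ∂(boundaryMeasure Ω), x ∈ closure Ω :=
  (ae_restrict_mem isClosed_frontier.measurableSet).mono fun _ hx => frontier_subset_closure hx

/-- The gradient of a smooth function is its weak gradient. -/
lemma hasWeakGradient_gradient {f : EuclideanSpace ℝ (Fin d) → ℝ}
    (hf : ContDiff ℝ ∞ f) : HasWeakGradient Ω f (gradient f) := by
  intro φ hφ v
  have hfd : Continuous fun x => fderiv ℝ f x v :=
    (hf.continuous_fderiv (by simp)).clm_apply continuous_const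
  have hφd : Continuous fun x => fderiv ℝ φ x v :=
    (hφ.contDiff.continuous_fderiv (by simp)).clm_apply continuous_const
  have hφds : HasCompactSupport fun x => fderiv ℝ φ x v :=
    hφ.hasCompactSupport.fderiv_apply ℝ v
  have z1 : ∀ x, x ∉ Ω → φ x = 0 := fun x hx =>
    image_eq_zero_of_notMem_tsupport fun h => hx (hφ.tsupport_subset h)
  have z2 : ∀ x, x ∉ Ω → fderiv ℝ φ x v = 0 := fun x hx => by
    rw [fderiv_of_notMem_tsupport ℝ fun h => hx (hφ.tsupport_subset h)]; rfl
  rw [setIntegral_eq_integral_of_forall_compl_eq_zero (fun x hx => by rw [z2 x hx, mul_zero]),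
    setIntegral_eq_integral_of_forall_compl_eq_zero (fun x hx => by rw [z1 x hx, zero_mul])]
  have := integral_mul_fderiv_eq_neg_fderiv_mul_of_integrable (μ := volume) (f := f) (g := φ) (v := v)
    ((hfd.mul hφ.contDiff.continuous).integrable_of_hasCompactSupport
      hφ.hasCompactSupport.mul_left)
    ((hf.continuous.mul hφd).integrable_of_hasCompactSupport hφds.mul_left)
    ((hf.continuous.mul hφ.contDiff.continuous).integrable_of_hasCompactSupport
      hφ.hasCompactSupport.mul_left)
    (fun x _ => (hf.differentiable (by simp)).differentiableAt)
    (fun x _ => (hφ.contDiff.differentiable (by simp)).differentiableAt)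
  rw [this]
  simp only [inner_gradient_left, mul_comm]

/-- A smooth function defines an element of `H¹(Ω) ∩ C(closure Ω)`. -/
lemma exists_H1_of_contDiff (hΩ : IsOpen Ω) (hb : Bornology.IsBounded Ω)
    [IsFiniteMeasure (boundaryMeasure Ω)] {f : EuclideanSpace ℝ (Fin d) → ℝ}
    (hf : ContDiff ℝ ∞ f) :
    ∃ (p : H1 Ω) (g : Lp ℝ 2 (boundaryMeasure Ω)), IsContinuousWithRestriction Ω p g ∧
      toL2 p =ᵐ[volume.restrict Ω] f ∧ grad p =ᵐ[volume.restrict Ω] gradient f ∧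
      g =ᵐ[boundaryMeasure Ω] f := by
  have := isFiniteMeasure_restrict hb
  have hg : Continuous (gradient f) :=
    (InnerProductSpace.toDual ℝ (EuclideanSpace ℝ (Fin d))).symm.continuous.comp
      (hf.continuous_fderiv (by simp))
  obtain ⟨p, hp1, hp2⟩ := exists_H1
    (memLp_of_continuousOn_closure hb hf.continuous.continuousOn
      hf.continuous.aestronglyMeasurable (ae_mem_closure hΩ))
    (memLp_of_continuousOn_closure hb hg.continuousOn hg.aestronglyMeasurable (ae_mem_closure hΩ))
    (hasWeakGradient_gradient hf)
  have hm : MemLp f 2 (boundaryMeasure Ω) := memLp_of_continuousOn_closure hb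
    hf.continuous.continuousOn hf.continuous.aestronglyMeasurable ae_boundary_mem_closure
  exact ⟨p, hm.toLp f, ⟨f, hf.continuous.continuousOn, hp1, hm.coeFn_toLp⟩, hp1, hp2, hm.coeFn_toLp⟩

/-- Normal contractions operate on `H¹(Ω) ∩ C(closure Ω)`. -/
lemma IsContinuousWithRestriction.exists_comp (hΩ : IsOpen Ω) (hb : Bornology.IsBounded Ω)
    [IsFiniteMeasure (boundaryMeasure Ω)] {u : H1 Ω} {g : Lp ℝ 2 (boundaryMeasure Ω)}
    (h : IsContinuousWithRestriction Ω u g) {F F' : ℝ → ℝ}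
    (hF : ∀ x, HasDerivAt F (F' x) x) (hF' : Continuous F') (hF1 : ∀ x, |F' x| ≤ 1) :
    ∃ (u' : H1 Ω) (g' : Lp ℝ 2 (boundaryMeasure Ω)), IsContinuousWithRestriction Ω u' g' ∧
      ‖grad u'‖ ≤ ‖grad u‖ ∧ g' =ᵐ[boundaryMeasure Ω] fun x => F (g x) := by
  have := isFiniteMeasure_restrict hb
  obtain ⟨w₀, hw₀, huw₀, hgw₀⟩ := h
  have hFc : Continuous F := continuous_iff_continuousAt.2 fun x => (hF x).continuousAt
  let w : EuclideanSpace ℝ (Fin d) → ℝ := (closure Ω).indicator w₀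
  have hww : EqOn w w₀ (closure Ω) := fun x hx => indicator_of_mem hx w₀
  have hw : ContinuousOn w (closure Ω) := hw₀.congr hww
  have hwm : Measurable w := by
    classical
    rw [show w = (closure Ω).piecewise w₀ 0 from (piecewise_eq_indicator ..).symm]
    exact hw₀.measurable_piecewise continuousOn_const isClosed_closure.measurableSet
  have huw : toL2 u =ᵐ[volume.restrict Ω] w := by
    filter_upwards [huw₀, ae_mem_closure hΩ] with x hx hxc
    rw [hx, hww hxc]
  have hgw : g =ᵐ[boundaryMeasure Ω] w := by
    filter_upwards [hgw₀, ae_boundary_mem_closure] with x hx hxc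
    rw [hx, hww hxc]
  have hFw : ContinuousOn (fun x => F (w x)) (closure Ω) := hFc.comp_continuousOn hw
  -- Square integrability comes from boundedness on the compact closure and finiteness of the
  -- measures, so F 0 = 0 plays no role.
  have m1 : MemLp (fun x => F (w x)) 2 (volume.restrict Ω) := memLp_of_continuousOn_closure hb hFw
    (hFc.measurable.comp hwm).aestronglyMeasurable (ae_mem_closure hΩ)
  have m2 : MemLp (fun x => F (w x)) 2 (boundaryMeasure Ω) := memLp_of_continuousOn_closure hb hFw
    (hFc.measurable.comp hwm).aestronglyMeasurable ae_boundary_mem_closure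
  have hbd : ∀ x, ‖F' (w x) • grad u x‖ ≤ ‖grad u x‖ := fun x => by
    rw [norm_smul]
    exact mul_le_of_le_one_left (norm_nonneg _) (hF1 _)
  have m3 : MemLp (fun x => F' (w x) • grad u x) 2 (volume.restrict Ω) :=
    (Lp.memLp (grad u)).mono
      ((hF'.measurable.comp hwm).aestronglyMeasurable.smul (Lp.aestronglyMeasurable _))
      (Eventually.of_forall hbd)
  obtain ⟨u', hu1, hu2⟩ := exists_H1 m1 m3
    (((hasWeakGradient_grad u).congr huw .rfl).comp hΩ hwm (hw.mono subset_closure)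
      ((integrableOn_of_Lp hb (toL2 u)).congr huw) (Lp.stronglyMeasurable _)
      (integrableOn_of_Lp hb (grad u)) hF hF' hF1 (m1.integrable (by norm_num)))
  refine ⟨u', m2.toLp _, ⟨_, hFw, hu1, m2.coeFn_toLp⟩, ?_, ?_⟩
  · refine Lp.norm_le_norm_of_ae_le ?_
    filter_upwards [hu2] with x hx
    rw [hx]
    exact hbd x
  · filter_upwards [m2.coeFn_toLp, hgw] with x hx hx'
    rw [hx, hx']

end Sobolev
-- Density of the domain and Lax–Milgram.
section Abstract

open scoped InnerProductSpace

/-- A single-valued monotone relation with full range after adding positive multiples of the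
identity is densely defined. -/
lemma IsMaximalMonotone.of_single_valued {H : Type*} [NormedAddCommGroup H] [InnerProductSpace ℝ H]
    [CompleteSpace H] {D : Submodule ℝ (H × H)} (h1 : ∀ p ∈ D, 0 ≤ ⟪p.1, p.2⟫_ℝ)
    (h2 : ∀ l : ℝ, 0 < l → ∀ f : H, ∃ x : H, (x, f - l • x) ∈ D)
    (h3 : ∀ y, ((0 : H), y) ∈ D → y = 0) : IsMaximalMonotone D := by
  refine ⟨h1, h2, ?_⟩
  have hset : {x : H | ∃ y, (x, y) ∈ D} = (D.map (LinearMap.fst ℝ H H) : Set H) := by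
    ext x
    simp
  rw [hset, Submodule.dense_iff_topologicalClosure_eq_top, Submodule.topologicalClosure_eq_top_iff,
    Submodule.eq_bot_iff]
  intro f hf
  -- For f orthogonal to the domain and f - x in Dx, monotonicity reads 0 ≤ ⟪x, f - x⟫ = -‖x‖². Thus
  -- x = 0 and (0, f) lies in D.
  obtain ⟨x, hx⟩ := h2 1 one_pos f
  have hxm : x ∈ D.map (LinearMap.fst ℝ H H) := ⟨_, hx, rfl⟩
  have e1 := (Submodule.mem_orthogonal _ _).1 hf x hxm
  have e2 := h1 _ hx
  rw [one_smul] at hx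
  simp only [one_smul, inner_sub_right, e1, real_inner_self_eq_norm_sq] at e2
  have e3 : x = 0 :=
    norm_eq_zero.1 (pow_eq_zero_iff two_ne_zero |>.1 (le_antisymm (by linarith) (sq_nonneg _)))
  rw [e3, sub_zero] at hx
  exact h3 f hx

/-- The Lax–Milgram theorem for the form `⟪G q, G p⟫ + l ⟪T q, T p⟫` on a closed subspace. -/
lemma exists_form_eq_inner {W X Y : Type*} [NormedAddCommGroup W] [InnerProductSpace ℝ W]
    [NormedAddCommGroup X] [InnerProductSpace ℝ X] [NormedAddCommGroup Y] [InnerProductSpace ℝ Y]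
    [CompleteSpace Y] (K : Submodule ℝ W) [CompleteSpace K] (G : W →L[ℝ] X) (T : W →L[ℝ] Y)
    {l c : ℝ} (hc : 0 < c) (h : ∀ p ∈ K, c * ‖p‖ ^ 2 ≤ ‖G p‖ ^ 2 + l * ‖T p‖ ^ 2) (f : Y) :
    ∃ q ∈ K, ∀ p ∈ K, ⟪G q, G p⟫_ℝ + l * ⟪T q, T p⟫_ℝ = ⟪f, T p⟫_ℝ := by
  let G' := G.comp K.subtypeL
  let T' := T.comp K.subtypeL
  let B : K →L[ℝ] K →L[ℝ] ℝ :=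
    (innerSL ℝ).bilinearComp G' G' + l • (innerSL ℝ).bilinearComp T' T'
  have hB : ∀ p q : K, B p q = ⟪G p, G q⟫_ℝ + l * ⟪T p, T q⟫_ℝ := fun _ _ => rfl
  have hcoer : IsCoercive B := ⟨c, hc, fun p => by
    rw [hB, real_inner_self_eq_norm_sq, real_inner_self_eq_norm_sq, mul_assoc, ← sq]
    exact h p p.2⟩
  let q : K := hcoer.continuousLinearEquivOfBilin.symm (T'.adjoint f)
  refine ⟨q, q.2, fun p hp => ?_⟩
  rw [← hB q ⟨p, hp⟩, ← hcoer.continuousLinearEquivOfBilin_apply,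
    ContinuousLinearEquiv.apply_symm_apply, ContinuousLinearMap.adjoint_inner_left]
  rfl

end Abstract

/-! ### The distributional Laplacian through the weak gradient. -/

section Laplacian

open scoped InnerProductSpace

variable {d : ℕ} {Ω : Set (EuclideanSpace ℝ (Fin d))}

lemma IsTestFunction.fderiv_apply {φ : EuclideanSpace ℝ (Fin d) → ℝ} (h : IsTestFunction Ω φ)
    (v : EuclideanSpace ℝ (Fin d)) : IsTestFunction Ω (fun x => fderiv ℝ φ x v) := by
  refine ⟨?_, h.hasCompactSupport.fderiv_apply ℝ v, ?_⟩
  · exact (h.contDiff.fderiv_right (m := ∞) (by simp)).clm_apply contDiff_const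
  · exact (tsupport_fderiv_apply_subset ℝ v).trans h.tsupport_subset

lemma laplacian_eq_sum_fderiv {φ : EuclideanSpace ℝ (Fin d) → ℝ} (h : ContDiff ℝ ∞ φ)
    (x : EuclideanSpace ℝ (Fin d)) :
    Laplacian.laplacian φ x = ∑ i, fderiv ℝ (fun y => fderiv ℝ φ y (EuclideanSpace.basisFun (Fin d) ℝ i)) x
      (EuclideanSpace.basisFun (Fin d) ℝ i) := by
  rw [InnerProductSpace.laplacian_eq_iteratedFDeriv_orthonormalBasis φ
    (EuclideanSpace.basisFun (Fin d) ℝ)]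
  refine Finset.sum_congr rfl fun i _ => ?_
  have hd : DifferentiableAt ℝ (fderiv ℝ φ) x :=
    ((h.fderiv_right (m := ∞) (by simp)).differentiable (by simp)).differentiableAt
  rw [iteratedFDeriv_two_apply, fderiv_clm_apply hd (differentiableAt_const _)]
  simp

/-- Each partial derivative of φ is again a test function; the weak gradient identity is applied to
it in the same direction and summed. -/
lemma HasWeakGradient.integral_mul_laplacian {u : EuclideanSpace ℝ (Fin d) → ℝ}
    {G : EuclideanSpace ℝ (Fin d) → EuclideanSpace ℝ (Fin d)}
    (hu : MemLp u 2 (volume.restrict Ω)) (hG : MemLp G 2 (volume.restrict Ω))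
    (h : HasWeakGradient Ω u G) {φ : EuclideanSpace ℝ (Fin d) → ℝ} (hφ : IsTestFunction Ω φ) :
    ∫ x in Ω, u x * Laplacian.laplacian φ x = - ∫ x in Ω, ⟪G x, gradient φ x⟫_ℝ := by
  let b := EuclideanSpace.basisFun (Fin d) ℝ
  have e1 : ∀ x, ⟪G x, gradient φ x⟫_ℝ = ∑ i, fderiv ℝ φ x (b i) * ⟪G x, b i⟫_ℝ := by
    intro x
    rw [← b.sum_inner_mul_inner]
    refine Finset.sum_congr rfl fun i _ => ?_
    rw [mul_comm, real_inner_comm, inner_gradient_left]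
  simp only [laplacian_eq_sum_fderiv hφ.contDiff, e1, Finset.mul_sum]
  rw [integral_finsetSum, integral_finsetSum, ← Finset.sum_neg_distrib]
  · exact Finset.sum_congr rfl fun i _ => h _ (hφ.fderiv_apply (b i)) (b i)
  · exact fun i _ => (hφ.fderiv_apply (b i)).memLp.integrable_mul (hG.inner_const _)
  · exact fun i _ => hu.integrable_mul ((hφ.fderiv_apply (b i)).memLp_fderiv (b i))

end Laplacian

/-! ### The form domain and the weak formulation of D₀. -/

section Form

open scoped InnerProductSpace

variable {d : ℕ} {Ω : Set (EuclideanSpace ℝ (Fin d))}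

/-- The weak gradient as a bounded operator on `H¹(Ω)`. -/
def gradL (Ω : Set (EuclideanSpace ℝ (Fin d))) :
    H1 Ω →L[ℝ] Lp (EuclideanSpace ℝ (Fin d)) 2 (volume.restrict Ω) :=
  (WithLp.sndL 2 ℝ _ _).comp (H1 Ω).subtypeL

/-- The embedding of `H¹(Ω)` into `L₂(Ω)`. -/
def toL2L (Ω : Set (EuclideanSpace ℝ (Fin d))) : H1 Ω →L[ℝ] Lp ℝ 2 (volume.restrict Ω) :=
  (WithLp.fstL 2 ℝ _ _).comp (H1 Ω).subtypeL

lemma norm_H1_sq (u : H1 Ω) : ‖u‖ ^ 2 = ‖toL2 u‖ ^ 2 + ‖grad u‖ ^ 2 :=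
  WithLp.prod_norm_sq_eq_of_L2 _

lemma toL2_add (u v : H1 Ω) : toL2 (u + v) = toL2 u + toL2 v := rfl

lemma toL2_smul (c : ℝ) (u : H1 Ω) : toL2 (c • u) = c • toL2 u := rfl

lemma IsContinuousWithRestriction.zero : IsContinuousWithRestriction Ω 0 0 :=
  ⟨0, continuousOn_const, Lp.coeFn_zero _ _ _, Lp.coeFn_zero _ _ _⟩

lemma IsContinuousWithRestriction.add {u v : H1 Ω} {g h : Lp ℝ 2 (boundaryMeasure Ω)}
    (hu : IsContinuousWithRestriction Ω u g) (hv : IsContinuousWithRestriction Ω v h) :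
    IsContinuousWithRestriction Ω (u + v) (g + h) := by
  obtain ⟨w, hw, hw1, hw2⟩ := hu
  obtain ⟨z, hz, hz1, hz2⟩ := hv
  refine ⟨w + z, hw.add hz, ?_, (Lp.coeFn_add g h).trans (hw2.add hz2)⟩
  rw [toL2_add]
  exact (Lp.coeFn_add _ _).trans (hw1.add hz1)

lemma IsContinuousWithRestriction.smul (c : ℝ) {u : H1 Ω} {g : Lp ℝ 2 (boundaryMeasure Ω)}
    (hu : IsContinuousWithRestriction Ω u g) :
    IsContinuousWithRestriction Ω (c • u) (c • g) := by
  obtain ⟨w, hw, hw1, hw2⟩ := hu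
  refine ⟨c • w, hw.const_smul c, ?_, (Lp.coeFn_smul c g).trans (hw2.const_smul c)⟩
  rw [toL2_smul]
  exact (Lp.coeFn_smul _ _).trans (hw1.const_smul c)

/-- The pairs `(u, u|_Γ)` with `u ∈ H¹(Ω) ∩ C(closure Ω)`. -/
def continuousPairs (Ω : Set (EuclideanSpace ℝ (Fin d))) :
    Submodule ℝ (WithLp 2 (H1 Ω × Lp ℝ 2 (boundaryMeasure Ω))) where
  carrier := {p | IsContinuousWithRestriction Ω p.fst p.snd}
  zero_mem' := IsContinuousWithRestriction.zero
  add_mem' {_ _} hp hq := IsContinuousWithRestriction.add hp hq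
  smul_mem' c _ hp := IsContinuousWithRestriction.smul c hp

/-- The pairs `(u, φ)` such that `φ` is a trace of `u ∈ H¹(Ω)`. -/
def tracePairs (Ω : Set (EuclideanSpace ℝ (Fin d))) :
    Submodule ℝ (WithLp 2 (H1 Ω × Lp ℝ 2 (boundaryMeasure Ω))) :=
  (continuousPairs Ω).topologicalClosure

lemma continuousPairs_le_tracePairs : continuousPairs Ω ≤ tracePairs Ω :=
  Submodule.le_topologicalClosure _

instance : CompleteSpace (tracePairs Ω) :=
  (Submodule.isClosed_topologicalClosure _).completeSpace_coe

lemma mem_tracePairs_iff (p : WithLp 2 (H1 Ω × Lp ℝ 2 (boundaryMeasure Ω))) :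
    p ∈ tracePairs Ω ↔ IsTrace Ω p.fst p.snd := by
  rw [← SetLike.mem_coe, tracePairs, Submodule.topologicalClosure_coe, mem_closure_iff_seq_limit]
  constructor
  · rintro ⟨s, hs, hlim⟩
    exact ⟨fun n => (s n).fst, fun n => (s n).snd, hs,
      ((WithLp.fstL 2 ℝ (H1 Ω) (Lp ℝ 2 (boundaryMeasure Ω))).continuous.tendsto p).comp hlim,
      ((WithLp.sndL 2 ℝ (H1 Ω) (Lp ℝ 2 (boundaryMeasure Ω))).continuous.tendsto p).comp hlim⟩
  · rintro ⟨us, gs, h, hu, hg⟩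
    exact ⟨fun n => WithLp.toLp 2 (us n, gs n), h,
      ((WithLp.prod_continuous_toLp 2 _ _).tendsto (p.fst, p.snd)).comp (hu.prodMk_nhds hg)⟩

lemma tracePairs_induction {P : WithLp 2 (H1 Ω × Lp ℝ 2 (boundaryMeasure Ω)) → Prop}
    (hP : IsClosed {p | P p}) (h : ∀ p ∈ continuousPairs Ω, P p) : ∀ p ∈ tracePairs Ω, P p :=
  fun _ hp => closure_minimal (show (continuousPairs Ω : Set _) ⊆ {p | P p} from h) hP hp

lemma integral_inner_grad (u v : H1 Ω) :
    ∫ x in Ω, ⟪grad u x, grad v x⟫_ℝ = ⟪grad u, grad v⟫_ℝ := (L2.inner_def _ _).symm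

lemma continuous_grad_fst :
    Continuous fun p : WithLp 2 (H1 Ω × Lp ℝ 2 (boundaryMeasure Ω)) => grad p.fst :=
  (gradL Ω).continuous.comp (WithLp.fstL 2 ℝ (H1 Ω) (Lp ℝ 2 (boundaryMeasure Ω))).continuous

lemma continuous_toL2_fst :
    Continuous fun p : WithLp 2 (H1 Ω × Lp ℝ 2 (boundaryMeasure Ω)) => toL2 p.fst :=
  (toL2L Ω).continuous.comp (WithLp.fstL 2 ℝ (H1 Ω) (Lp ℝ 2 (boundaryMeasure Ω))).continuous

lemma continuous_pair_snd :
    Continuous fun p : WithLp 2 (H1 Ω × Lp ℝ 2 (boundaryMeasure Ω)) => p.snd :=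
  (WithLp.sndL 2 ℝ (H1 Ω) (Lp ℝ 2 (boundaryMeasure Ω))).continuous

lemma exists_norm_toL2_sq_le_of_mem_tracePairs (hd : 1 ≤ d) (hΩ : IsOpen Ω)
    (hb : Bornology.IsBounded Ω) :
    ∃ C : ℝ, 0 ≤ C ∧ ∀ p ∈ tracePairs Ω,
      ‖toL2 p.fst‖ ^ 2 ≤ C * (‖grad p.fst‖ ^ 2 + ‖p.snd‖ ^ 2) := by
  obtain ⟨C, hC, h⟩ := exists_norm_toL2_sq_le hd hΩ hb
  refine ⟨C, hC, tracePairs_induction (isClosed_le ?_ ?_) fun p hp => h _ _ hp⟩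
  · exact continuous_toL2_fst.norm.pow 2
  · exact continuous_const.mul ((continuous_grad_fst.norm.pow 2).add (continuous_pair_snd.norm.pow 2))

/-- Harmonicity together with the normal derivative amounts to a single weak identity. -/
lemma harmonic_normalDerivative_iff (hΩ : IsOpen Ω) (hb : Bornology.IsBounded Ω)
    [IsFiniteMeasure (boundaryMeasure Ω)] (u : H1 Ω) (ψ : Lp ℝ 2 (boundaryMeasure Ω)) :
    (HasWeakLaplacian Ω (toL2 u) 0 ∧ HasNormalDerivative Ω u ψ) ↔
      ∀ p ∈ tracePairs Ω, ⟪grad u, grad p.fst⟫_ℝ = ⟪ψ, p.snd⟫_ℝ := by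
  constructor
  · rintro ⟨h0, h, hh, hN⟩
    -- The L₂ Laplacian in the definition of the normal derivative is determined by its action on
    -- test functions, so it is the zero Laplacian of u.
    have hz : h =ᵐ[volume.restrict Ω] 0 := by
      have := hΩ.ae_eq_zero_of_integral_contDiff_smul_eq_zero (μ := volume) (f := h)
        (integrableOn_of_Lp hb h).locallyIntegrableOn fun φ h1 h2 h3 => by
          have hφ : IsTestFunction Ω φ := ⟨h1, h2, h3⟩
          have a1 := (hh φ hφ).symm.trans (h0 φ hφ)
          simp only [Pi.zero_apply, zero_mul, integral_zero] at a1
          rw [← a1, setIntegral_eq_integral_of_forall_compl_eq_zero]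
          · simp only [smul_eq_mul, mul_comm]
          · intro x hx
            rw [image_eq_zero_of_notMem_tsupport fun hc => hx (h3 hc), mul_zero]
      exact (ae_restrict_iff' hΩ.measurableSet).2 this
    refine tracePairs_induction (isClosed_eq ?_ ?_) fun p hp => ?_
    · exact continuous_const.inner continuous_grad_fst
    · exact continuous_const.inner continuous_pair_snd
    · have a1 := hN _ _ hp
      have a2 : ∫ x in Ω, h x * toL2 p.fst x = 0 :=
        integral_eq_zero_of_ae (hz.mono fun x hx => by simp [hx])
      rwa [a2, zero_add, integral_inner_grad, integral_mul_eq_inner] at a1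
  · intro h
    have h0 : HasWeakLaplacian Ω (toL2 u) 0 := by
      intro φ hφ
      rw [(hasWeakGradient_grad u).integral_mul_laplacian (Lp.memLp _) (Lp.memLp _) hφ]
      -- A test function is an admissible pair with boundary value 0, its support lying in the open
      -- set Ω; the boundary term therefore drops out.
      obtain ⟨p, g, hpg, -, hp, hg⟩ := exists_H1_of_contDiff hΩ hb hφ.contDiff
      have a1 := h (WithLp.toLp 2 (p, g)) (continuousPairs_le_tracePairs hpg)
      have hg0 : g = 0 := by
        refine Lp.ext ((hg.trans ?_).trans (Lp.coeFn_zero _ _ _).symm)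
        filter_upwards [ae_restrict_mem isClosed_frontier.measurableSet] with x hx
        refine image_eq_zero_of_notMem_tsupport fun hc => ?_
        rw [hΩ.frontier_eq] at hx
        exact hx.2 (hφ.tsupport_subset hc)
      rw [hg0] at a1
      change ⟪grad u, grad p⟫_ℝ = ⟪ψ, 0⟫_ℝ at a1
      rw [inner_zero_right, L2.inner_def] at a1
      have a2 : ∫ x in Ω, ⟪grad u x, gradient φ x⟫_ℝ = 0 := by
        rw [← a1]
        exact integral_congr_ae (hp.mono fun x hx => by simp only [hx])
      rw [a2]
      simp
    refine ⟨h0, 0, ?_, fun v g hvg => ?_⟩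
    · intro φ hφ
      rw [h0 φ hφ]
      exact integral_congr_ae ((Lp.coeFn_zero ℝ 2 (volume.restrict Ω)).mono fun x hx => by
        simp only [hx])
    · have a1 := h (WithLp.toLp 2 (v, g)) (continuousPairs_le_tracePairs hvg)
      have a2 : ∫ x in Ω, (0 : Lp ℝ 2 (volume.restrict Ω)) x * toL2 v x = 0 :=
        integral_eq_zero_of_ae ((Lp.coeFn_zero ℝ 2 (volume.restrict Ω)).mono fun x hx => by
          simp only [hx, Pi.zero_apply, zero_mul])
      rw [a2, zero_add, integral_inner_grad, integral_mul_eq_inner]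
      exact a1

lemma mem_dtnGraph_iff (hΩ : IsOpen Ω) (hb : Bornology.IsBounded Ω)
    [IsFiniteMeasure (boundaryMeasure Ω)] (x y : Lp ℝ 2 (boundaryMeasure Ω)) :
    (x, y) ∈ dtnGraph Ω ↔ ∃ q ∈ tracePairs Ω, q.snd = x ∧
      ∀ p ∈ tracePairs Ω, ⟪grad q.fst, grad p.fst⟫_ℝ = ⟪y, p.snd⟫_ℝ := by
  constructor
  · rintro ⟨u, h1, h2, h3⟩
    exact ⟨WithLp.toLp 2 (u, x), (mem_tracePairs_iff _).2 h2, rfl,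
      (harmonic_normalDerivative_iff hΩ hb u y).1 ⟨h1, h3⟩⟩
  · rintro ⟨q, hq, rfl, h⟩
    obtain ⟨h1, h3⟩ := (harmonic_normalDerivative_iff hΩ hb q.fst y).2 h
    exact ⟨q.fst, h1, (mem_tracePairs_iff q).1 hq, h3⟩

end Form
-- D₀ is maximal monotone.
section Operator

open scoped InnerProductSpace

variable {d : ℕ} {Ω : Set (EuclideanSpace ℝ (Fin d))}

lemma grad_add (u v : H1 Ω) : grad (u + v) = grad u + grad v := rfl

lemma grad_smul (c : ℝ) (u : H1 Ω) : grad (c • u) = c • grad u := rfl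

/-- The graph of the Dirichlet-to-Neumann operator as a linear relation. -/
def dtnSubmodule (hΩ : IsOpen Ω) (hb : Bornology.IsBounded Ω)
    [IsFiniteMeasure (boundaryMeasure Ω)] :
    Submodule ℝ (Lp ℝ 2 (boundaryMeasure Ω) × Lp ℝ 2 (boundaryMeasure Ω)) where
  carrier := dtnGraph Ω
  zero_mem' := (mem_dtnGraph_iff hΩ hb 0 0).2 ⟨0, Submodule.zero_mem _, rfl, fun p _ => by
    rw [inner_zero_left]
    exact inner_zero_left _⟩
  add_mem' := by
    rintro ⟨x, y⟩ ⟨x', y'⟩ h h'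
    obtain ⟨q, hq, hqx, hqy⟩ := (mem_dtnGraph_iff hΩ hb x y).1 h
    obtain ⟨q', hq', hqx', hqy'⟩ := (mem_dtnGraph_iff hΩ hb x' y').1 h'
    refine (mem_dtnGraph_iff hΩ hb _ _).2 ⟨q + q', Submodule.add_mem _ hq hq', ?_, fun p hp => ?_⟩
    · rw [WithLp.add_snd, hqx, hqx']
    · rw [WithLp.add_fst, grad_add, inner_add_left, inner_add_left, hqy p hp, hqy' p hp]
  smul_mem' := by
    rintro c ⟨x, y⟩ h
    obtain ⟨q, hq, hqx, hqy⟩ := (mem_dtnGraph_iff hΩ hb x y).1 h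
    refine (mem_dtnGraph_iff hΩ hb _ _).2 ⟨c • q, Submodule.smul_mem _ c hq, ?_, fun p hp => ?_⟩
    · rw [WithLp.smul_snd, hqx]
    · rw [WithLp.smul_fst, grad_smul, real_inner_smul_left, real_inner_smul_left, hqy p hp]

lemma inner_nonneg_of_mem_dtnGraph (hΩ : IsOpen Ω) (hb : Bornology.IsBounded Ω)
    [IsFiniteMeasure (boundaryMeasure Ω)] {x y : Lp ℝ 2 (boundaryMeasure Ω)}
    (h : (x, y) ∈ dtnGraph Ω) : 0 ≤ ⟪x, y⟫_ℝ := by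
  obtain ⟨q, hq, rfl, hqy⟩ := (mem_dtnGraph_iff hΩ hb x y).1 h
  rw [real_inner_comm, ← hqy q hq]
  exact real_inner_self_nonneg

/-- Testing the pair (u, 0) with itself gives ∇u = 0. Then y is orthogonal to the restriction of
every smooth compactly supported function, which forces y = 0. -/
lemma eq_zero_of_zero_mem_dtnGraph (hΩ : IsOpen Ω) (hb : Bornology.IsBounded Ω)
    [IsFiniteMeasure (boundaryMeasure Ω)] {y : Lp ℝ 2 (boundaryMeasure Ω)}
    (h : ((0 : Lp ℝ 2 (boundaryMeasure Ω)), y) ∈ dtnGraph Ω) : y = 0 := by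
  obtain ⟨q, hq, hq0, hqy⟩ := (mem_dtnGraph_iff hΩ hb 0 y).1 h
  have h1 := hqy q hq
  rw [hq0, inner_zero_right] at h1
  have h2 : grad q.fst = 0 := inner_self_eq_zero.1 h1
  have hae := ae_eq_zero_of_integral_contDiff_smul_eq_zero (μ := boundaryMeasure Ω) (f := y)
    ((Lp.memLp y).integrable (by norm_num)).locallyIntegrable fun φ hφ _ => by
      obtain ⟨p, g, hpg, -, -, hg⟩ := exists_H1_of_contDiff hΩ hb hφ
      have h3 := hqy (WithLp.toLp 2 (p, g)) (continuousPairs_le_tracePairs hpg)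
      rw [h2, inner_zero_left] at h3
      change 0 = ⟪y, g⟫_ℝ at h3
      rw [← integral_mul_eq_inner] at h3
      rw [h3]
      refine integral_congr_ae (hg.mono fun x hx => ?_)
      simp only [hx, smul_eq_mul, mul_comm]
  exact Lp.ext (EventuallyEq.trans hae (Lp.coeFn_zero _ _ _).symm)

lemma exists_coercivity_constant (hd : 1 ≤ d) (hΩ : IsOpen Ω) (hb : Bornology.IsBounded Ω) {l : ℝ}
    (hl : 0 < l) : ∃ c : ℝ, 0 < c ∧ ∀ p ∈ tracePairs Ω,
      c * ‖p‖ ^ 2 ≤ ‖grad p.fst‖ ^ 2 + l * ‖p.snd‖ ^ 2 := by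
  obtain ⟨C, hC, h⟩ := exists_norm_toL2_sq_le_of_mem_tracePairs hd hΩ hb
  have hm : 0 < min 1 l := lt_min one_pos hl
  -- Maz'ya's inequality bounds ‖p‖² by C + 1 times the form with weights 1 and 1; the factor `min 1
  -- l` adjusts the weights to 1 and l.
  refine ⟨min 1 l / (C + 1), by positivity, fun p hp => ?_⟩
  rw [div_mul_eq_mul_div, div_le_iff₀ (by positivity), WithLp.prod_norm_sq_eq_of_L2, norm_H1_sq]
  have h2 := h p hp
  have h3 : min 1 l * ‖grad p.fst‖ ^ 2 ≤ 1 * ‖grad p.fst‖ ^ 2 :=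
    mul_le_mul_of_nonneg_right (min_le_left _ _) (sq_nonneg _)
  have h4 : min 1 l * ‖p.snd‖ ^ 2 ≤ l * ‖p.snd‖ ^ 2 :=
    mul_le_mul_of_nonneg_right (min_le_right _ _) (sq_nonneg _)
  calc min 1 l * (‖toL2 p.fst‖ ^ 2 + ‖grad p.fst‖ ^ 2 + ‖p.snd‖ ^ 2)
      ≤ min 1 l * ((C + 1) * (‖grad p.fst‖ ^ 2 + ‖p.snd‖ ^ 2)) :=
        mul_le_mul_of_nonneg_left (by linarith) hm.le
    _ = (min 1 l * ‖grad p.fst‖ ^ 2 + min 1 l * ‖p.snd‖ ^ 2) * (C + 1) := by ring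
    _ ≤ _ := mul_le_mul_of_nonneg_right (by linarith) (by linarith)

lemma exists_mem_dtnGraph (hd : 1 ≤ d) (hΩ : IsOpen Ω) (hb : Bornology.IsBounded Ω)
    [IsFiniteMeasure (boundaryMeasure Ω)] {l : ℝ} (hl : 0 < l) (f : Lp ℝ 2 (boundaryMeasure Ω)) :
    ∃ x, (x, f - l • x) ∈ dtnGraph Ω := by
  obtain ⟨c, hc, h⟩ := exists_coercivity_constant hd hΩ hb hl
  obtain ⟨q, hq, hqp⟩ := exists_form_eq_inner (tracePairs Ω)
    ((gradL Ω).comp (WithLp.fstL 2 ℝ (H1 Ω) (Lp ℝ 2 (boundaryMeasure Ω))))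
    (WithLp.sndL 2 ℝ (H1 Ω) (Lp ℝ 2 (boundaryMeasure Ω))) hc h f
  refine ⟨q.snd, (mem_dtnGraph_iff hΩ hb _ _).2 ⟨q, hq, rfl, fun p hp => ?_⟩⟩
  have h1 : ⟪grad q.fst, grad p.fst⟫_ℝ + l * ⟪q.snd, p.snd⟫_ℝ = ⟪f, p.snd⟫_ℝ := hqp p hp
  rw [inner_sub_left, real_inner_smul_left]
  linarith

lemma isMaximalMonotone_dtnSubmodule (hd : 1 ≤ d) (hΩ : IsOpen Ω) (hb : Bornology.IsBounded Ω)
    [IsFiniteMeasure (boundaryMeasure Ω)] : IsMaximalMonotone (dtnSubmodule hΩ hb) :=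
  .of_single_valued (fun _ hp => inner_nonneg_of_mem_dtnGraph hΩ hb hp)
    (fun _ hl f => exists_mem_dtnGraph hd hΩ hb hl f)
    (fun _ hy => eq_zero_of_zero_mem_dtnGraph hΩ hb hy)

end Operator

/-! ### Positivity of the resolvent and the fixed constant function. -/

section Positivity

open scoped InnerProductSpace

variable {d : ℕ} {Ω : Set (EuclideanSpace ℝ (Fin d))}

lemma inner_nonneg_of_nonneg {α : Type*} [MeasurableSpace α] {μ : Measure α} {f g : Lp ℝ 2 μ}
    (hf : 0 ≤ f) (hg : 0 ≤ g) : 0 ≤ ⟪f, g⟫_ℝ := by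
  rw [← integral_mul_eq_inner]
  refine integral_nonneg_of_ae ?_
  filter_upwards [(Lp.coeFn_nonneg f).2 hf, (Lp.coeFn_nonneg g).2 hg] with x h1 h2
  exact mul_nonneg h1 h2

lemma smul_nonneg_Lp {α : Type*} [MeasurableSpace α] {μ : Measure α} {a : ℝ} (ha : 0 ≤ a)
    {f : Lp ℝ 2 μ} (hf : 0 ≤ f) : 0 ≤ a • f := by
  rw [← Lp.coeFn_nonneg] at hf ⊢
  filter_upwards [hf, Lp.coeFn_smul a f] with x h1 h2
  rw [h2]
  exact mul_nonneg ha h1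

/-- A smooth approximation of the absolute value. -/
def smoothAbs (ε x : ℝ) : ℝ := √(x ^ 2 + ε ^ 2) - ε

lemma hasDerivAt_smoothAbs {ε : ℝ} (hε : 0 < ε) (x : ℝ) :
    HasDerivAt (smoothAbs ε) (x / √(x ^ 2 + ε ^ 2)) x := by
  have h1 : HasDerivAt (fun y : ℝ => y ^ 2 + ε ^ 2) (2 * x) x := by
    simpa using (hasDerivAt_pow 2 x).add_const (ε ^ 2)
  have h2 := (h1.sqrt (by positivity)).sub_const ε
  exact h2.congr_deriv (mul_div_mul_left _ _ two_ne_zero)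

lemma continuous_div_sqrt {ε : ℝ} (hε : 0 < ε) :
    Continuous fun x : ℝ => x / √(x ^ 2 + ε ^ 2) :=
  continuous_id.div (by fun_prop) fun x => by positivity

lemma abs_div_sqrt_le {ε : ℝ} (hε : 0 < ε) (x : ℝ) : |x / √(x ^ 2 + ε ^ 2)| ≤ 1 := by
  rw [abs_div, abs_of_nonneg (Real.sqrt_nonneg _), div_le_one (by positivity)]
  exact Real.abs_le_sqrt (by nlinarith)

/-- The subtraction of ε in `smoothAbs` is made for this bound, which keeps the boundary norm from
growing; the error stays at most ε. -/
lemma smoothAbs_le {ε : ℝ} (hε : 0 < ε) (x : ℝ) : smoothAbs ε x ≤ |x| := by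
  rw [smoothAbs, sub_le_iff_le_add, Real.sqrt_le_left (by positivity), add_sq, sq_abs]
  have : 0 ≤ 2 * |x| * ε := by positivity
  linarith

lemma smoothAbs_nonneg (ε x : ℝ) : 0 ≤ smoothAbs ε x := by
  rw [smoothAbs, sub_nonneg]
  exact Real.le_sqrt_of_sq_le (by nlinarith)

lemma abs_sub_le_smoothAbs {ε : ℝ} (x : ℝ) : |x| - ε ≤ smoothAbs ε x := by
  rw [smoothAbs]
  gcongr
  exact Real.abs_le_sqrt (by nlinarith)

/-- The absolute value operates on the trace pairs up to an arbitrarily small error. -/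
lemma IsContinuousWithRestriction.exists_smoothAbs (hΩ : IsOpen Ω) (hb : Bornology.IsBounded Ω)
    [IsFiniteMeasure (boundaryMeasure Ω)] {u : H1 Ω} {g : Lp ℝ 2 (boundaryMeasure Ω)}
    (h : IsContinuousWithRestriction Ω u g) {ε : ℝ} (hε : 0 < ε) :
    ∃ (u' : H1 Ω) (g' : Lp ℝ 2 (boundaryMeasure Ω)), IsContinuousWithRestriction Ω u' g' ∧
      ‖grad u'‖ ≤ ‖grad u‖ ∧ ‖g'‖ ≤ ‖g‖ ∧
      ‖g' - |g|‖ ≤ ε * ‖Lp.const 2 (boundaryMeasure Ω) (1 : ℝ)‖ := by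
  obtain ⟨u', g', h1, h2, h3⟩ := h.exists_comp hΩ hb (hasDerivAt_smoothAbs hε)
    (continuous_div_sqrt hε) (abs_div_sqrt_le hε)
  refine ⟨u', g', h1, h2, ?_, ?_⟩
  · refine Lp.norm_le_norm_of_ae_le (h3.mono fun x hx => ?_)
    rw [hx, Real.norm_eq_abs, abs_of_nonneg (smoothAbs_nonneg _ _)]
    exact smoothAbs_le hε _
  · refine Lp.norm_le_mul_norm_of_ae_le_mul ?_
    filter_upwards [h3, Lp.coeFn_sub g' |g|, Lp.coeFn_abs g,
      Lp.coeFn_const (p := 2) (μ := boundaryMeasure Ω) (1 : ℝ)] with x hx h4 h5 h6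
    rw [h4, Pi.sub_apply, h5, hx, h6, Real.norm_eq_abs, Function.const_apply, norm_one, mul_one,
      abs_le]
    constructor
    · linarith [abs_sub_le_smoothAbs (ε := ε) (g x)]
    · linarith [smoothAbs_le hε (g x)]

/-- The resolvent of the Dirichlet-to-Neumann operator is positive. -/
lemma nonneg_of_mem_dtnGraph (hΩ : IsOpen Ω) (hb : Bornology.IsBounded Ω)
    [IsFiniteMeasure (boundaryMeasure Ω)] {l : ℝ} (hl : 0 < l) {f x : Lp ℝ 2 (boundaryMeasure Ω)}
    (hf : 0 ≤ f) (h : (x, l • (f - x)) ∈ dtnGraph Ω) : 0 ≤ x := by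
  obtain ⟨q, hq, hqx, hqy⟩ := (mem_dtnGraph_iff hΩ hb _ _).1 h
  -- The weak equation makes q a minimiser of the right-hand functional. Completing the square gives
  -- an excess of ‖∇(p - q)‖² + l‖p.snd - x‖², of which the second term is kept.
  have hJ : ∀ p ∈ tracePairs Ω, l * ‖p.snd - x‖ ^ 2
      + (‖grad q.fst‖ ^ 2 + l * ‖x‖ ^ 2 - 2 * l * ⟪f, x⟫_ℝ)
      ≤ ‖grad p.fst‖ ^ 2 + l * ‖p.snd‖ ^ 2 - 2 * l * ⟪f, p.snd⟫_ℝ := by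
    intro p hp
    have h1 := hqy p hp
    have h2 := hqy q hq
    rw [hqx] at h2
    rw [real_inner_smul_left, inner_sub_left] at h1 h2
    rw [real_inner_self_eq_norm_sq, real_inner_self_eq_norm_sq] at h2
    have h3 := norm_sub_sq_real (grad p.fst) (grad q.fst)
    have h4 := norm_sub_sq_real p.snd x
    rw [real_inner_comm] at h3 h4
    have h5 := sq_nonneg ‖grad p.fst - grad q.fst‖
    rw [h4]
    nlinarith
  obtain ⟨s, hs, hslim⟩ : ∃ s : ℕ → WithLp 2 (H1 Ω × Lp ℝ 2 (boundaryMeasure Ω)),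
      (∀ n, s n ∈ continuousPairs Ω) ∧ Tendsto s atTop (𝓝 q) := mem_closure_iff_seq_limit.1 hq
  let ε : ℕ → ℝ := fun n => 1 / ((n : ℝ) + 1)
  have hε : ∀ n, 0 < ε n := fun n => by positivity
  have hεlim : Tendsto ε atTop (𝓝 0) := tendsto_one_div_add_atTop_nhds_zero_nat
  choose u' g' h1 h2 h3 h4 using fun n =>
    IsContinuousWithRestriction.exists_smoothAbs hΩ hb (hs n) (hε n)
  have hgrad : Tendsto (fun n => grad (s n).fst) atTop (𝓝 (grad q.fst)) :=
    (continuous_grad_fst.tendsto q).comp hslim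
  have hsnd : Tendsto (fun n => (s n).snd) atTop (𝓝 x) := by
    rw [← hqx]
    exact (continuous_pair_snd.tendsto q).comp hslim
  have habs : Tendsto (fun n => |(s n).snd|) atTop (𝓝 |x|) := by
    rw [tendsto_iff_norm_sub_tendsto_zero] at hsnd ⊢
    exact squeeze_zero (fun _ => norm_nonneg _) (fun n => norm_abs_sub_abs _ _) hsnd
  have hg' : Tendsto g' atTop (𝓝 |x|) := by
    have : Tendsto (fun n => g' n - |(s n).snd|) atTop (𝓝 0) :=
      squeeze_zero_norm h4 (by simpa using hεlim.mul_const _)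
    simpa using this.add habs
  have hL : Tendsto (fun n => l * ‖g' n - x‖ ^ 2
      + (‖grad q.fst‖ ^ 2 + l * ‖x‖ ^ 2 - 2 * l * ⟪f, x⟫_ℝ)) atTop
      (𝓝 (l * ‖|x| - x‖ ^ 2 + (‖grad q.fst‖ ^ 2 + l * ‖x‖ ^ 2 - 2 * l * ⟪f, x⟫_ℝ))) :=
    ((((hg'.sub_const x).norm.pow 2).const_mul l)).add_const _
  -- The gradient of u' n enters only through the bound by that of s n, so it need not converge.
  have hR : Tendsto (fun n => ‖grad (s n).fst‖ ^ 2 + l * ‖(s n).snd‖ ^ 2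
      - 2 * l * ⟪f, g' n⟫_ℝ) atTop
      (𝓝 (‖grad q.fst‖ ^ 2 + l * ‖x‖ ^ 2 - 2 * l * ⟪f, |x|⟫_ℝ)) :=
    ((hgrad.norm.pow 2).add ((hsnd.norm.pow 2).const_mul l)).sub
      ((tendsto_const_nhds.inner hg').const_mul _)
  have hle := le_of_tendsto_of_tendsto' hL hR fun n => by
    refine (hJ _ (continuousPairs_le_tracePairs (show WithLp.toLp 2 (u' n, g' n) ∈ _ from h1 n))).trans ?_
    have a1 : ‖grad (u' n)‖ ^ 2 ≤ ‖grad (s n).fst‖ ^ 2 := by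
      gcongr; exact h2 n
    have a2 : ‖g' n‖ ^ 2 ≤ ‖(s n).snd‖ ^ 2 := by
      gcongr; exact h3 n
    have a3 : l * ‖g' n‖ ^ 2 ≤ l * ‖(s n).snd‖ ^ 2 := mul_le_mul_of_nonneg_left a2 hl.le
    change ‖grad (u' n)‖ ^ 2 + l * ‖g' n‖ ^ 2 - 2 * l * ⟪f, g' n⟫_ℝ ≤ _
    linarith
  -- The sign of f enters here: the linear term favours |x|, so |x| does at least as well as the
  -- minimiser and must equal x.
  have hpos : 0 ≤ ⟪f, |x|⟫_ℝ - ⟪f, x⟫_ℝ := by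
    rw [← inner_sub_right]
    exact inner_nonneg_of_nonneg hf (sub_nonneg.2 (le_abs_self x))
  have hz : l * ‖|x| - x‖ ^ 2 ≤ 0 := by nlinarith
  have hz' : ‖|x| - x‖ = 0 := by
    have : ‖|x| - x‖ ^ 2 ≤ 0 := nonpos_of_mul_nonpos_right hz hl
    exact pow_eq_zero_iff two_ne_zero |>.1 (le_antisymm this (sq_nonneg _))
  rw [← sub_eq_zero.1 (norm_eq_zero.1 hz')]
  exact abs_nonneg x

lemma const_one_mem_dtnGraph (hΩ : IsOpen Ω) (hb : Bornology.IsBounded Ω)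
    [IsFiniteMeasure (boundaryMeasure Ω)] :
    (Lp.const 2 (boundaryMeasure Ω) (1 : ℝ), (0 : Lp ℝ 2 (boundaryMeasure Ω))) ∈ dtnGraph Ω := by
  obtain ⟨p, g, hpg, -, hp, hg⟩ := exists_H1_of_contDiff hΩ hb
    (contDiff_const (c := (1 : ℝ)) (E := EuclideanSpace ℝ (Fin d)))
  have hgrad : grad p = 0 := by
    refine Lp.ext ((hp.trans (Eventually.of_forall fun x => ?_)).trans (Lp.coeFn_zero _ _ _).symm)
    simp
  refine (mem_dtnGraph_iff hΩ hb _ _).2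
    ⟨WithLp.toLp 2 (p, g), continuousPairs_le_tracePairs hpg, ?_, fun q _ => ?_⟩
  · exact Lp.ext (hg.trans (Lp.coeFn_const (p := 2) (μ := boundaryMeasure Ω) (1 : ℝ)).symm)
  · change ⟪grad p, _⟫_ℝ = _
    rw [hgrad, inner_zero_left, inner_zero_left]

end Positivity
end DirichletNeumann
end

theorem proposition3p7 (d : ℕ) (hd : 2 ≤ d) (Ω : Set (EuclideanSpace ℝ (Fin d)))
    (hΩ_open : IsOpen Ω) (hΩ_conn : IsConnected Ω) (hΩ_bdd : Bornology.IsBounded Ω)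
    [IsFiniteMeasure (DirichletNeumann.boundaryMeasure Ω)] :
    (∃! S : DirichletNeumann.C0Semigroup (Lp ℝ 2 (DirichletNeumann.boundaryMeasure Ω)),
      DirichletNeumann.IsGeneratedByNegDtN Ω S) ∧
    ∀ S : DirichletNeumann.C0Semigroup (Lp ℝ 2 (DirichletNeumann.boundaryMeasure Ω)),
      DirichletNeumann.IsGeneratedByNegDtN Ω S → S.IsMarkovian := by
  have hD := DirichletNeumann.isMaximalMonotone_dtnSubmodule (by omega) hΩ_open hΩ_bdd
  -- The invariant closed convex cone is that of the nonnegative functions.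
  obtain ⟨S, hS, -, hpos, hfix⟩ := hD.exists_semigroup (K := Ici 0) isClosed_Ici (mem_Ici.2 le_rfl)
    (fun x hx y hy => mem_Ici.2 (add_nonneg (mem_Ici.1 hx) (mem_Ici.1 hy))) (fun a ha x hx => DirichletNeumann.smul_nonneg_Lp ha hx)
    (fun l hl f hf x hx => DirichletNeumann.nonneg_of_mem_dtnGraph hΩ_open hΩ_bdd hl hf hx)
  have huniq : ∀ S', DirichletNeumann.IsGeneratedByNegDtN Ω S' → S' = S := fun S' hS' =>
    DirichletNeumann.C0Semigroup.eq_of_generatorGraph hD hS' hS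
  refine ⟨⟨S, hS, huniq⟩, fun S' hS' => ?_⟩
  rw [huniq S' hS']
  exact fun t _ => ⟨fun f hf => hpos t f hf,
    hfix _ (DirichletNeumann.const_one_mem_dtnGraph hΩ_open hΩ_bdd) t⟩
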